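/- **Proposition 4.2.** For a transitive subgroup $H\le S_8$ and a polynomial $p\in\mathbb{Q}[x]$ with eight distinct roots in its splitting field, write $\mathrm{Gal}(p)=H$ if, for some labelling of these roots by $1,\dots,8$, the group of permutations of the labels induced by the Galois group of $p$ over $\mathbb{Q}$ is equal to $H$. Equivalently, for every labelling it is conjugate to $H$ in $S_8$. Let $8Tj$ denote the $j$-th conjugacy class of transitive subgroups of $S_8$ in the list of Butler and McKay, represented as follows, with $\gamma=(1\,2\,3\,8)(4\,5\,6\,7)$, $\varepsilon_1=(1\,8)(2\,3)(4\,5)(6\,7)$, $\varepsilon_2=(1\,3)(2\,8)(4\,6)(5\,7)$, $\varepsilon_3=(1\,5)(2\,6)(3\,7)(4\,8)$: - $8T2=\langle\gamma,\varepsilon_3\rangle$ (regular, $\cong C_4\times C_2$); - $8T3=\langle\varepsilon_1,\varepsilon_2,\varepsilon_3\rangle$ (regular, $\cong C_2^3$); - $8T4=\langle\gamma,(1\,6)(2\,5)(3\,4)(7\,8)\rangle$ (regular, dihedral of order $8$); - $8T9=\langle\varepsilon_1,\varepsilon_2,\varepsilon_3,(4\,5)(6\,7)\rangle$ (order $16$);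 - $8T10=\langle\gamma,(1\,5)(3\,7)\rangle$ (order $16$); - $8T18=\langle\varepsilon_1,\varepsilon_2,\varepsilon_3,(4\,5)(6\,7),(4\,6)(5\,7)\rangle$ (order $32$). Write $E_4$, $C_4$, $D_4$ for the elementary abelian group of order $4$, the cyclic group of order $4$ and the dihedral group of order $8$. For $a,b\in\mathbb{Q}$ let $f(x)=x^8+ax^6+bx^4+ax^2+1$ and $g(x)=x^4+ax^3+bx^2+ax+1$, so that $f(x)=g(x^2)$. Suppose that $a\neq 0$ and that $f$ is irreducible over $\mathbb{Q}$. Then: 1. if $\mathrm{Gal}(g)\cong E_4$, then $\mathrm{Gal}(f)$ is $8T2$, $8T3$, $8T4$ or $8T9$; 2. if $\mathrm{Gal}(g)\cong C_4$, then $\mathrm{Gal}(f)$ is $8T2$ or $8T10$; 3. if $\mathrm{Gal}(g)\cong D_4$, then $\mathrm{Gal}(f)$ is $8T4$, $8T9$, $8T10$ or $8T18$. Moreover, each of these ten possibilities for the pair $(\mathrm{Gal}(g),\mathrm{Gal}(f))$ occurs for some $a,b\in\mathbb{Q}$ with $a\ne0$ and $f$ irreducible over $\mathbb{Q}$. -/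

import Mathlib

open Polynomial

/-- The palindromic quartic `x⁴ + a x³ + b x² + a x + 1` over the rationals. -/
noncomputable def palindromicQuartic (a b : ℚ) : ℚ[X] :=
  X ^ 4 + C a * X ^ 3 + C b * X ^ 2 + C a * X + 1

/-- The palindromic even octic `x⁸ + a x⁶ + b x⁴ + a x² + 1` over the rationals. -/
noncomputable def palindromicEvenOctic (a b : ℚ) : ℚ[X] :=
  X ^ 8 + C a * X ^ 6 + C b * X ^ 4 + C a * X ^ 2 + 1

theorem palindromicEvenOctic_eq_comp (a b : ℚ) :
    palindromicEvenOctic a b = (palindromicQuartic a b).comp (X ^ 2) := by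
  simp only [palindromicEvenOctic, palindromicQuartic, add_comp, mul_comp, pow_comp, X_comp,
    C_comp, one_comp]
  ring

/-- The Galois group of `p`, as a group of permutations of the roots of `p`, is the permutation
group `H` up to a labelling of the roots: for some bijection `e` from `{0, …, n - 1}` onto the set
of roots of `p` in its splitting field, `H` consists exactly of those permutations `σ` of the
labels which are induced by an automorphism `φ` in the Galois group of `p`. As the labelling is
arbitrary, this depends only on the conjugacy class of `H` in the symmetric group. -/
def HasGaloisPermGroup {n : ℕ} (p : ℚ[X]) (H : Subgroup (Equiv.Perm (Fin n))) : Prop :=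
  ∃ e : Fin n ≃ p.rootSet p.SplittingField, ∀ σ : Equiv.Perm (Fin n),
    σ ∈ H ↔ ∃ φ : p.Gal, ∀ i : Fin n, φ (e i : p.SplittingField) = e (σ i)

/- Representatives of conjugacy classes of transitive subgroups of the symmetric group on the
eight letters `0, …, 7`, in the numbering of Butler and McKay (the usual letters `1, …, 8` are
reduced modulo `8`). -/

/-- The transitive group 8T2, the regular representation of `C₄ × C₂`. -/
def group8T2 : Subgroup (Equiv.Perm (Fin 8)) :=
  Subgroup.closure
    {c[1, 2, 3, 0] * c[4, 5, 6, 7],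
     c[1, 5] * c[2, 6] * c[3, 7] * c[4, 0]}

/-- The transitive group 8T3, the regular representation of `C₂ × C₂ × C₂`. -/
def group8T3 : Subgroup (Equiv.Perm (Fin 8)) :=
  Subgroup.closure
    {c[1, 0] * c[2, 3] * c[4, 5] * c[6, 7],
     c[1, 3] * c[2, 0] * c[4, 6] * c[5, 7],
     c[1, 5] * c[2, 6] * c[3, 7] * c[4, 0]}

/-- The transitive group 8T4, the regular representation of the dihedral group of order 8. -/
def group8T4 : Subgroup (Equiv.Perm (Fin 8)) :=
  Subgroup.closure
    {c[1, 2, 3, 0] * c[4, 5, 6, 7],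
     c[1, 6] * c[2, 5] * c[3, 4] * c[7, 0]}

/-- The transitive group 8T9, of order 16, isomorphic to `D₄ × C₂`. -/
def group8T9 : Subgroup (Equiv.Perm (Fin 8)) :=
  Subgroup.closure
    {c[1, 0] * c[2, 3] * c[4, 5] * c[6, 7],
     c[1, 3] * c[2, 0] * c[4, 6] * c[5, 7],
     c[1, 5] * c[2, 6] * c[3, 7] * c[4, 0],
     c[4, 5] * c[6, 7]}

/-- The transitive group 8T10, of order 16, isomorphic to a semidirect product of `C₂ × C₂`
by `C₄`. -/
def group8T10 : Subgroup (Equiv.Perm (Fin 8)) :=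
  Subgroup.closure
    {c[1, 2, 3, 0] * c[4, 5, 6, 7],
     c[1, 5] * c[3, 7]}

/-- The transitive group 8T18, of order 32, isomorphic to the wreath product of `C₂ × C₂`
by `C₂`. -/
def group8T18 : Subgroup (Equiv.Perm (Fin 8)) :=
  Subgroup.closure
    {c[1, 0] * c[2, 3] * c[4, 5] * c[6, 7],
     c[1, 3] * c[2, 0] * c[4, 6] * c[5, 7],
     c[1, 5] * c[2, 6] * c[3, 7] * c[4, 0],
     c[4, 5] * c[6, 7],
     c[4, 6] * c[5, 7]}

/-- `G` is elementary abelian of order four. -/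
def IsE4 (G : Type*) [Group G] : Prop := Nonempty (G ≃* Multiplicative (ZMod 2 × ZMod 2))

/-- `G` is cyclic of order four. -/
def IsC4 (G : Type*) [Group G] : Prop := Nonempty (G ≃* Multiplicative (ZMod 4))

/-- `G` is dihedral of order eight. -/
def IsD4 (G : Type*) [Group G] : Prop := Nonempty (G ≃* DihedralGroup 4)

/-! The group V = (ℤ/2)² acts on the roots of f by y ↦ ±y^{±1}, and this action commutes with every
field automorphism (`map_signInv`). For f irreducible the roots form two free orbits Vr and Vs, told
apart by u = r² + r⁻² and v = s² + s⁻², the roots of t² + at + (b - 2), whose discriminant is D = a²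
- 4b + 8. Hence the Galois group G lies in the wreath product of V by C₂. It is described by the
group K ⊆ V × V of pairs of translations induced on the two blocks (`BlockRel`) and by the z ∈ V for
which some γ ∈ G satisfies γr = s, γs = zr (`PreBlockFrame`). K is symmetric, contains (z, z), and
projects onto V by transitivity.

Few such K exist. Call a character χ of V invariant if χ(x) = χ(y) on K. If no nonzero χ is
invariant, K is V × V and G is 8T18. If two are, all are, K is the diagonal, and G is 8T3 or 8T2
according as z = 0 or not. If exactly one is, then either K contains some (0, c) with c ≠ 0 and is
all of {χ(x) = χ(y)}, giving 8T9 or 8T10 according as χ(z) is 0 or 1, or K is the graph of an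
involution, giving 8T4. Moving the base point s inside its orbit normalises z. The roots of g are
r^{±2}, s^{±2}, so only second coordinates act on them: Gal(g) is E₄ or C₄ if the second coordinate
is an invariant character (according to z.2), and D₄ otherwise. Combining the two descriptions gives
`hasGaloisPermGroup_cases`.

For the examples, the nonzero characters are carried by the functions y + y⁻¹, y - y⁻¹, y² - y⁻².
The squared products N of their values at r and s are P = b + 2 - 2a, Q = b + 2 + 2a and PQ. Galois
theory shows that χ is invariant with χ(z) = 0 when N is a square, invariant with χ(z) = 1 when ND
is a square, and not invariant otherwise (`blockInvariant_of_isSquare`,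
`blockInvariant_of_isSquare_mul`, `isSquare_of_blockInvariant`). Similar criteria separate 8T4 from
8T9 (`isSquare_of_graph`, `eq_zero_of_isSquare`) and give irreducibility
(`palindromicEvenOctic_irreducible`), so every example reduces to deciding which rational numbers
are squares. -/

/-! ### Groups commuting with a free action on two blocks. -/

/-- The permutation of `V × Bool` (two copies of `V`) which translates the first copy by `x` and
the second one by `y`, and exchanges the copies if `τ` is true. -/
def wreathAct {V : Type*} [Add V] (x y : V) (τ : Bool) (w : V × Bool) : V × Bool :=
  (w.1 + (if w.2 then y else x), xor w.2 τ)

/-- A group `G` acts on the union of two free orbits `a V p`, `a V q` of an action `a` of `V`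
commuting with `G`, and some element of `G` maps `p` to `q` and `q` to `a z p`. -/
structure PreBlockFrame {V Y : Type*} [AddCommGroup V] (G : Type*) [Group G] [MulAction G Y]
    (a : V → Y → Y) (p q : Y) (z : V) : Prop where
  add : ∀ v w y, a (v + w) y = a v (a w y)
  zero : ∀ y, a 0 y = y
  smul : ∀ (g : G) v y, g • a v y = a v (g • y)
  inj : ∀ v w, a v p = a w p → v = w
  disj : ∀ v w, a v p ≠ a w q
  cover : ∀ g : G, (∃ x, g • p = a x p) ∨ ∃ x, g • p = a x q
  swap : ∃ g : G, g • p = q ∧ g • q = a z p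

/-- A `PreBlockFrame` for which the action of `G` is transitive. -/
structure BlockFrame {V Y : Type*} [AddCommGroup V] (G : Type*) [Group G] [MulAction G Y]
    (a : V → Y → Y) (p q : Y) (z : V) : Prop extends PreBlockFrame G a p q z where
  surj : ∀ x, ∃ g : G, g • p = a x p

/-- The pairs of translations of the two blocks induced by elements of `G`. -/
def BlockRel {V Y : Type*} (G : Type*) [Group G] [MulAction G Y]
    (a : V → Y → Y) (p q : Y) (x y : V) : Prop :=
  ∃ g : G, g • p = a x p ∧ g • q = a y q

namespace PreBlockFrame

variable {V Y G : Type*} [AddCommGroup V] [Group G] [MulAction G Y]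
  {a : V → Y → Y} {p q : Y} {z : V}

theorem inj_right (F : PreBlockFrame G a p q z) (v w : V) (h : a v q = a w q) : v = w := by
  obtain ⟨g, hg, -⟩ := F.swap
  rw [← hg, ← F.smul, ← F.smul] at h
  exact F.inj _ _ (smul_left_cancel g h)

/-- If `g` sent `q` into the block of `p`, that image would already be attained by `g` on the block
of `p`, against injectivity of `g` and disjointness of the blocks. -/
theorem stab_right (F : PreBlockFrame G a p q z) {g : G} {x : V} (h : g • p = a x p) :
    ∃ y, g • q = a y q := by
  obtain ⟨γ, hγ, -⟩ := F.swap
  rcases F.cover (g * γ) with ⟨y, hy⟩ | ⟨y, hy⟩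
  · exfalso
    rw [mul_smul, hγ] at hy
    have : g • q = g • a (y - x) p := by
      rw [hy, F.smul, h, ← F.add, sub_add_cancel]
    have := smul_left_cancel g this
    exact F.disj (y - x) 0 (by rw [F.zero, ← this])
  · exact ⟨y, by rw [← hy, mul_smul, hγ]⟩

/-- Multiplication by γ⁻¹ turns an element exchanging the blocks into one preserving them; `z`
enters because γ sends `q` to `a z p`. -/
theorem swap_rel (F : PreBlockFrame G a p q z) {x y : V} :
    (∃ g : G, g • p = a x q ∧ g • q = a y p) ↔ BlockRel G a p q x (y - z) := by
  obtain ⟨γ, hγ, hγ'⟩ := F.swap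
  constructor
  · rintro ⟨g, hp, hq⟩
    refine ⟨γ⁻¹ * g, ?_, ?_⟩
    · rw [mul_smul, hp, inv_smul_eq_iff, F.smul, hγ]
    · rw [mul_smul, hq, inv_smul_eq_iff, F.smul, hγ', ← F.add, sub_add_cancel]
  · rintro ⟨g, hp, hq⟩
    refine ⟨γ * g, ?_, ?_⟩
    · rw [mul_smul, hp, F.smul, hγ]
    · rw [mul_smul, hq, F.smul, hγ', ← F.add, sub_add_cancel]

theorem cases (F : PreBlockFrame G a p q z) (g : G) :
    (∃ x y, g • p = a x p ∧ g • q = a y q) ∨ ∃ x y, g • p = a x q ∧ g • q = a y p := by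
  rcases F.cover g with ⟨x, hx⟩ | ⟨x, hx⟩
  · obtain ⟨y, hy⟩ := F.stab_right hx
    exact .inl ⟨x, y, hx, hy⟩
  · obtain ⟨γ, hγ, hγ'⟩ := F.swap
    have h1 : (γ⁻¹ * g) • p = a x p := by rw [mul_smul, hx, inv_smul_eq_iff, F.smul, hγ]
    obtain ⟨y, hy⟩ := F.stab_right h1
    rw [mul_smul, inv_smul_eq_iff, F.smul, hγ', ← F.add] at hy
    exact .inr ⟨x, _, hx, hy⟩

theorem rel_add (F : PreBlockFrame G a p q z) {x y x' y' : V} (h : BlockRel G a p q x y)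
    (h' : BlockRel G a p q x' y') : BlockRel G a p q (x + x') (y + y') := by
  obtain ⟨g, hp, hq⟩ := h
  obtain ⟨g', hp', hq'⟩ := h'
  refine ⟨g' * g, ?_, ?_⟩
  · rw [mul_smul, hp, F.smul, hp', ← F.add]
  · rw [mul_smul, hq, F.smul, hq', ← F.add]

/-- Conjugation by γ exchanges the two translations; the contributions of `z` cancel because `V` is
commutative. -/
theorem rel_swap (F : PreBlockFrame G a p q z) {x y : V} (h : BlockRel G a p q x y) :
    BlockRel G a p q y x := by
  obtain ⟨g, hp, hq⟩ := h
  obtain ⟨γ, hγ, hγ'⟩ := F.swap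
  have h : BlockRel G a p q y (x + z - z) := by
    rw [← F.swap_rel]
    exact ⟨g * γ, by rw [mul_smul, hγ, hq], by
      rw [mul_smul, hγ', F.smul, hp, ← F.add, add_comm]⟩
  rwa [add_sub_cancel_right] at h

theorem rel_self (F : PreBlockFrame G a p q z) : BlockRel G a p q z z := by
  obtain ⟨γ, hγ, hγ'⟩ := F.swap
  exact ⟨γ * γ, by rw [mul_smul, hγ, hγ'], by rw [mul_smul, hγ', F.smul, hγ]⟩

end PreBlockFrame

namespace BlockFrame

variable {V Y G : Type*} [AddCommGroup V] [Group G] [MulAction G Y]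
  {a : V → Y → Y} {p q : Y} {z : V}

theorem rel_surj (F : BlockFrame G a p q z) (x : V) : ∃ y, BlockRel G a p q x y := by
  obtain ⟨g, hg⟩ := F.surj x
  obtain ⟨y, hy⟩ := F.stab_right hg
  exact ⟨y, g, hg, hy⟩

/-- Change of the second base point. -/
theorem shift (F : BlockFrame G a p q z) {x y : V} (h : BlockRel G a p q x y) :
    BlockFrame G a p (a x q) (x + y + z) where
  add := F.add
  zero := F.zero
  smul := F.smul
  inj := F.inj
  disj v w := by rw [← F.add]; exact F.disj _ _
  cover g := by
    refine (F.cover g).imp id ?_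
    rintro ⟨w, hw⟩
    exact ⟨w - x, by rw [← F.add, sub_add_cancel, hw]⟩
  swap := by
    obtain ⟨g, hp, hq⟩ := h
    obtain ⟨γ, hγ, hγ'⟩ := F.swap
    -- This product sends `p` to `a x q`, and sends `a x q` to the translate of `p` by `x + y + z`.
    refine ⟨γ * g, ?_, ?_⟩
    · rw [mul_smul, hp, F.smul, hγ]
    · rw [mul_smul, F.smul, hq, F.smul, F.smul, hγ', ← F.add, ← F.add, add_assoc]
  surj := F.surj

theorem rel_shift (F : BlockFrame G a p q z) (u x y : V) :
    BlockRel G a p (a u q) x y ↔ BlockRel G a p q x y := by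
  refine exists_congr fun g => and_congr_right fun _ => ?_
  rw [F.smul, ← F.add, add_comm, F.add]
  constructor
  · intro h
    have := congrArg (a (-u)) h
    rwa [← F.add, ← F.add (-u) u, neg_add_cancel, F.zero, F.zero] at this
  · intro h; rw [h]

/-- Change of coordinates in `V`. -/
theorem comp (F : BlockFrame G a p q z) {W : Type*} [AddCommGroup W] (θ : W ≃+ V) :
    BlockFrame G (fun w => a (θ w)) p q (θ.symm z) where
  add v w y := by rw [map_add, F.add]
  zero y := by rw [map_zero, F.zero]
  smul g v y := F.smul _ _ _
  inj v w h := θ.injective (F.inj _ _ h)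
  disj v w := F.disj _ _
  cover g := by
    refine (F.cover g).imp ?_ ?_ <;>
    · rintro ⟨w, hw⟩
      exact ⟨θ.symm w, by rw [hw, θ.apply_symm_apply]⟩
  swap := by simpa using F.swap
  surj x := F.surj _

section label

variable {n : ℕ} (ρ : Fin n ≃ V × Bool)

/-- The labelling of the points of the two blocks by means of `ρ`. -/
def label (a : V → Y → Y) (p q : Y) (ρ : Fin n ≃ V × Bool) (k : Fin n) : Y :=
  a (ρ k).1 (if (ρ k).2 then q else p)

theorem label_injective (F : BlockFrame G a p q z) : Function.Injective (label a p q ρ) := by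
  intro k l h
  apply ρ.injective
  unfold label at h
  rcases hk : ρ k with ⟨v, _ | _⟩ <;> rcases hl : ρ l with ⟨w, _ | _⟩ <;> simp [hk, hl] at h
  · rw [F.inj _ _ h]
  · exact absurd h (F.disj _ _)
  · exact absurd h.symm (F.disj _ _)
  · rw [F.inj_right _ _ h]

/-- All of `G` is encoded by `BlockRel` and `z`: an element exchanging the blocks is reduced to one
preserving them by `swap_rel`, which is the source of the correction of `y` by `z`. -/
theorem smul_label_iff (F : BlockFrame G a p q z) (σ : Equiv.Perm (Fin n)) :
    (∃ g : G, ∀ k, g • label a p q ρ k = label a p q ρ (σ k)) ↔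
      ∃ x y τ, BlockRel G a p q x (y - if τ then z else 0) ∧
        ∀ k, ρ (σ k) = wreathAct x y τ (ρ k) := by
  have key : ∀ (g : G) (x y : V) (τ : Bool), g • p = a x (if τ then q else p) →
      g • q = a y (if τ then p else q) → ∀ k, g • label a p q ρ k =
        label a p q ρ (ρ.symm (wreathAct x y τ (ρ k))) := by
    intro g x y τ hp hq k
    unfold label wreathAct
    rcases ρ k with ⟨v, _ | _⟩ <;> cases τ <;> simp_all [F.smul, F.add]
  constructor
  · rintro ⟨g, hg⟩
    rcases F.cases g with ⟨x, y, hp, hq⟩ | ⟨x, y, hp, hq⟩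
    · refine ⟨x, y, false, ?_, fun k => ?_⟩
      · simpa using ⟨g, hp, hq⟩
      · have := (hg k).symm.trans (key g x y false (by simpa) (by simpa) k)
        rw [F.label_injective ρ this, Equiv.apply_symm_apply]
    · refine ⟨x, y, true, ?_, fun k => ?_⟩
      · simpa using F.swap_rel.1 ⟨g, hp, hq⟩
      · have := (hg k).symm.trans (key g x y true (by simpa) (by simpa) k)
        rw [F.label_injective ρ this, Equiv.apply_symm_apply]
  · rintro ⟨x, y, τ, h, hσ⟩
    have : ∃ g : G, g • p = a x (if τ then q else p) ∧ g • q = a y (if τ then p else q) := by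
      cases τ
      · simpa [BlockRel] using h
      · simpa using F.swap_rel.2 h
    obtain ⟨g, hp, hq⟩ := this
    refine ⟨g, fun k => ?_⟩
    rw [key g x y τ hp hq k, ← hσ, Equiv.symm_apply_apply]

end label

end BlockFrame

/-! ### Matching with the explicit permutation groups of degree eight. -/

/-- A subgroup `H` of the symmetric group on `n` letters describes, up to a labelling `e` of points,
the action of `G`. -/
def IsLabelledBy {Y : Type*} (G : Type*) [Group G] [MulAction G Y] {n : ℕ}
    (H : Subgroup (Equiv.Perm (Fin n))) (e : Fin n → Y) : Prop :=
  ∀ σ : Equiv.Perm (Fin n), σ ∈ H ↔ ∃ g : G, ∀ i, g • e i = e (σ i)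

/-- One inclusion need only be tested on generators, the other only on the triples `(x, y, τ)`. For
explicit groups of degree eight both become finite checks. -/
theorem isLabelledBy_closure {V Y G : Type*} [AddCommGroup V] [Group G] [MulAction G Y]
    {a : V → Y → Y} {p q : Y} {z : V} (F : BlockFrame G a p q z) {n : ℕ} (ρ : Fin n ≃ V × Bool)
    (S : Set (Equiv.Perm (Fin n)))
    (hS : ∀ σ ∈ S, ∃ x y τ, BlockRel G a p q x (y - if τ then z else 0) ∧
        ∀ k, ρ (σ k) = wreathAct x y τ (ρ k))
    (hw : ∀ x y τ, BlockRel G a p q x (y - if τ then z else 0) →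
      ∃ σ ∈ Subgroup.closure S, ∀ k, ρ (σ k) = wreathAct x y τ (ρ k)) :
    IsLabelledBy G (Subgroup.closure S) (BlockFrame.label a p q ρ) := by
  intro σ
  constructor
  · intro hσ
    induction hσ using Subgroup.closure_induction with
    | mem σ h => exact (F.smul_label_iff ρ σ).2 (hS σ h)
    | one => exact ⟨1, by simp⟩
    | mul σ τ _ _ hσ hτ =>
      obtain ⟨g, hg⟩ := hσ
      obtain ⟨h, hh⟩ := hτ
      exact ⟨g * h, fun i => by rw [mul_smul, hh, hg, Equiv.Perm.mul_apply]⟩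
    | inv σ _ hσ =>
      obtain ⟨g, hg⟩ := hσ
      exact ⟨g⁻¹, fun i => by rw [inv_smul_eq_iff, hg]; simp⟩
  · intro h
    obtain ⟨x, y, τ, hK, hσ⟩ := (F.smul_label_iff ρ σ).1 h
    obtain ⟨σ', hσ', h'⟩ := hw x y τ hK
    convert hσ'
    ext1 k
    exact ρ.injective ((hσ k).trans (h' k).symm)

/-- Standard numbering of two copies of `(ℤ/2)²`. -/
def klein8 : Fin 8 → (ZMod 2 × ZMod 2) × Bool :=
  ![((0, 0), false), ((1, 0), false), ((0, 1), false), ((1, 1), false),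
    ((0, 0), true), ((1, 0), true), ((0, 1), true), ((1, 1), true)]

theorem klein8_bijective (σ : Fin 8 → Fin 8) (hσ : Function.Injective σ) :
    Function.Bijective (klein8 ∘ σ) :=
  (show Function.Bijective klein8 by decide).comp (Finite.injective_iff_bijective.1 hσ)

/-- Numbering of two copies of `(ℤ/2)²` obtained from the standard one by a permutation. -/
noncomputable def kleinLabel (σ : Fin 8 → Fin 8) (hσ : Function.Injective σ) :
    Fin 8 ≃ (ZMod 2 × ZMod 2) × Bool :=
  Equiv.ofBijective _ (klein8_bijective σ hσ)

section

variable {Y G : Type*} [Group G] [MulAction G Y]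
  {a : ZMod 2 × ZMod 2 → Y → Y} {p q : Y} {z : ZMod 2 × ZMod 2}

set_option maxRecDepth 10000 in
theorem isLabelledBy_group8T2 (F : BlockFrame G a p q (1, 0))
    (hK : ∀ x y, BlockRel G a p q x y ↔ y = x) :
    ∃ ρ, IsLabelledBy G group8T2 (BlockFrame.label a p q ρ) := by
  -- The points of the two blocks alternate, so that the first generator is the exchange p → q → zp
  -- → zq, and the second is the translation by (0, 1).
  refine ⟨kleinLabel ![0, 4, 1, 5, 2, 6, 3, 7] (by decide), isLabelledBy_closure F _ _ ?_ ?_⟩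
  · simp only [hK, Set.mem_insert_iff, Set.mem_singleton_iff, forall_eq_or_imp,
      forall_eq, kleinLabel, Equiv.ofBijective_apply]
    decide
  · have words : ∀ (x y : ZMod 2 × ZMod 2) (τ : Bool), (y - if τ then ((1, 0) : ZMod 2 × ZMod 2) else 0) = x →
      ∃ (i : Fin 4) (j : Fin 2), ∀ n,
        (klein8 ∘ ![0, 4, 1, 5, 2, 6, 3, 7]) (((c[1, 2, 3, 0] * c[4, 5, 6, 7] : Equiv.Perm (Fin 8)) ^ i.1 *
        (c[1, 5] * c[2, 6] * c[3, 7] * c[4, 0] : Equiv.Perm (Fin 8)) ^ j.1) n) =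
        wreathAct x y τ ((klein8 ∘ ![0, 4, 1, 5, 2, 6, 3, 7]) n) := by
      decide
    intro x y τ hxy
    obtain ⟨i, j, h⟩ := words x y τ ((hK _ _).1 hxy)
    simp only [kleinLabel, Equiv.ofBijective_apply]
    refine ⟨_, ?_, h⟩
    refine mul_mem ?_ ?_ <;> refine pow_mem ?_ _
    all_goals exact Subgroup.subset_closure (by simp)

set_option maxRecDepth 10000 in
theorem isLabelledBy_group8T3 (F : BlockFrame G a p q 0)
    (hK : ∀ x y, BlockRel G a p q x y ↔ y = x) :
    ∃ ρ, IsLabelledBy G group8T3 (BlockFrame.label a p q ρ) := by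
  -- In the standard numbering the first two generators are the translations by (1, 0) and (0, 1),
  -- and the third exchanges the blocks.
  refine ⟨kleinLabel ![0, 1, 2, 3, 4, 5, 6, 7] (by decide), isLabelledBy_closure F _ _ ?_ ?_⟩
  · simp only [hK, Set.mem_insert_iff, Set.mem_singleton_iff, forall_eq_or_imp,
      forall_eq, kleinLabel, Equiv.ofBijective_apply]
    decide
  · have words : ∀ (x y : ZMod 2 × ZMod 2) (τ : Bool), (y - if τ then (0 : ZMod 2 × ZMod 2) else 0) = x →
      ∃ (i : Fin 2) (j : Fin 2) (k : Fin 2), ∀ n,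
        (klein8 ∘ ![0, 1, 2, 3, 4, 5, 6, 7]) (((c[1, 0] * c[2, 3] * c[4, 5] * c[6, 7] : Equiv.Perm (Fin 8)) ^ i.1 *
        (c[1, 3] * c[2, 0] * c[4, 6] * c[5, 7] : Equiv.Perm (Fin 8)) ^ j.1 *
        (c[1, 5] * c[2, 6] * c[3, 7] * c[4, 0] : Equiv.Perm (Fin 8)) ^ k.1) n) =
        wreathAct x y τ ((klein8 ∘ ![0, 1, 2, 3, 4, 5, 6, 7]) n) := by
      decide
    intro x y τ hxy
    obtain ⟨i, j, k, h⟩ := words x y τ ((hK _ _).1 hxy)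
    simp only [kleinLabel, Equiv.ofBijective_apply]
    refine ⟨_, ?_, h⟩
    refine mul_mem (mul_mem ?_ ?_) ?_ <;> refine pow_mem ?_ _
    all_goals exact Subgroup.subset_closure (by simp)

set_option maxRecDepth 10000 in
theorem isLabelledBy_group8T4 (F : BlockFrame G a p q 0)
    (hK : ∀ x y, BlockRel G a p q x y ↔ y = (x.1 + x.2, x.2)) :
    ∃ ρ, IsLabelledBy G group8T4 (BlockFrame.label a p q ρ) := by
  -- The first generator becomes the exchange with x = (0, 1), y = (1, 1), whose square is the
  -- translation by (1, 0).
  refine ⟨kleinLabel ![0, 6, 1, 7, 2, 4, 3, 5] (by decide), isLabelledBy_closure F _ _ ?_ ?_⟩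
  · simp only [hK, Set.mem_insert_iff, Set.mem_singleton_iff, forall_eq_or_imp,
      forall_eq, kleinLabel, Equiv.ofBijective_apply]
    decide
  · have words : ∀ (x y : ZMod 2 × ZMod 2) (τ : Bool), (y - if τ then (0 : ZMod 2 × ZMod 2) else 0) = (x.1 + x.2, x.2) →
      ∃ (i : Fin 4) (j : Fin 2), ∀ n,
        (klein8 ∘ ![0, 6, 1, 7, 2, 4, 3, 5]) (((c[1, 2, 3, 0] * c[4, 5, 6, 7] : Equiv.Perm (Fin 8)) ^ i.1 *
        (c[1, 6] * c[2, 5] * c[3, 4] * c[7, 0] : Equiv.Perm (Fin 8)) ^ j.1) n) =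
        wreathAct x y τ ((klein8 ∘ ![0, 6, 1, 7, 2, 4, 3, 5]) n) := by
      decide
    intro x y τ hxy
    obtain ⟨i, j, h⟩ := words x y τ ((hK _ _).1 hxy)
    simp only [kleinLabel, Equiv.ofBijective_apply]
    refine ⟨_, ?_, h⟩
    refine mul_mem ?_ ?_ <;> refine pow_mem ?_ _
    all_goals exact Subgroup.subset_closure (by simp)

set_option maxRecDepth 10000 in
theorem isLabelledBy_group8T9 (F : BlockFrame G a p q 0)
    (hK : ∀ x y, BlockRel G a p q x y ↔ x.2 = y.2) :
    ∃ ρ, IsLabelledBy G group8T9 (BlockFrame.label a p q ρ) := by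
  refine ⟨kleinLabel ![0, 1, 2, 3, 4, 5, 6, 7] (by decide), isLabelledBy_closure F _ _ ?_ ?_⟩
  · simp only [hK, Set.mem_insert_iff, Set.mem_singleton_iff, forall_eq_or_imp,
      forall_eq, kleinLabel, Equiv.ofBijective_apply]
    decide
  · have words : ∀ (x y : ZMod 2 × ZMod 2) (τ : Bool), x.2 = (y - if τ then (0 : ZMod 2 × ZMod 2) else 0).2 →
      ∃ (i : Fin 2) (j : Fin 2) (k : Fin 2) (l : Fin 2), ∀ n,
        (klein8 ∘ ![0, 1, 2, 3, 4, 5, 6, 7]) (((c[1, 0] * c[2, 3] * c[4, 5] * c[6, 7] : Equiv.Perm (Fin 8)) ^ i.1 *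
        (c[1, 3] * c[2, 0] * c[4, 6] * c[5, 7] : Equiv.Perm (Fin 8)) ^ j.1 *
        (c[4, 5] * c[6, 7] : Equiv.Perm (Fin 8)) ^ k.1 *
        (c[1, 5] * c[2, 6] * c[3, 7] * c[4, 0] : Equiv.Perm (Fin 8)) ^ l.1) n) =
        wreathAct x y τ ((klein8 ∘ ![0, 1, 2, 3, 4, 5, 6, 7]) n) := by
      decide
    intro x y τ hxy
    obtain ⟨i, j, k, l, h⟩ := words x y τ ((hK _ _).1 hxy)
    simp only [kleinLabel, Equiv.ofBijective_apply]
    refine ⟨_, ?_, h⟩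
    refine mul_mem (mul_mem (mul_mem ?_ ?_) ?_) ?_ <;> refine pow_mem ?_ _
    all_goals exact Subgroup.subset_closure (by simp)

set_option maxRecDepth 10000 in
theorem isLabelledBy_group8T10 (F : BlockFrame G a p q (0, 1))
    (hK : ∀ x y, BlockRel G a p q x y ↔ x.2 = y.2) :
    ∃ ρ, IsLabelledBy G group8T10 (BlockFrame.label a p q ρ) := by
  refine ⟨kleinLabel ![0, 4, 2, 6, 1, 5, 3, 7] (by decide), isLabelledBy_closure F _ _ ?_ ?_⟩
  · simp only [hK, Set.mem_insert_iff, Set.mem_singleton_iff, forall_eq_or_imp,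
      forall_eq, kleinLabel, Equiv.ofBijective_apply]
    decide
  -- The 4-cycle generator is the exchange γ; the other one translates only the second block by (1,
  -- 0), so its conjugate by γ translates only the first. The words in these three account for the
  -- 16 elements.
  · have words : ∀ (x y : ZMod 2 × ZMod 2) (τ : Bool), x.2 = (y - if τ then ((0, 1) : ZMod 2 × ZMod 2) else 0).2 →
      ∃ (i : Fin 4) (j : Fin 2) (k : Fin 2), ∀ n,
        (klein8 ∘ ![0, 4, 2, 6, 1, 5, 3, 7]) (((c[1, 2, 3, 0] * c[4, 5, 6, 7] : Equiv.Perm (Fin 8)) ^ i.1 *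
        (c[1, 5] * c[3, 7] : Equiv.Perm (Fin 8)) ^ j.1 *
        ((c[1, 2, 3, 0] * c[4, 5, 6, 7] : Equiv.Perm (Fin 8)) * (c[1, 5] * c[3, 7] : Equiv.Perm (Fin 8)) * (c[1, 2, 3, 0] * c[4, 5, 6, 7] : Equiv.Perm (Fin 8))⁻¹) ^ k.1) n) =
        wreathAct x y τ ((klein8 ∘ ![0, 4, 2, 6, 1, 5, 3, 7]) n) := by
      decide
    intro x y τ hxy
    obtain ⟨i, j, k, h⟩ := words x y τ ((hK _ _).1 hxy)
    simp only [kleinLabel, Equiv.ofBijective_apply]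
    refine ⟨_, ?_, h⟩
    refine mul_mem (mul_mem ?_ ?_) ?_ <;> refine pow_mem ?_ _
    · exact Subgroup.subset_closure (by simp)
    · exact Subgroup.subset_closure (by simp)
    · refine mul_mem (mul_mem ?_ ?_) (inv_mem ?_) <;> exact Subgroup.subset_closure (by simp)

set_option maxRecDepth 10000 in
theorem isLabelledBy_group8T18 (F : BlockFrame G a p q 0)
    (hK : ∀ x y, BlockRel G a p q x y) :
    ∃ ρ, IsLabelledBy G group8T18 (BlockFrame.label a p q ρ) := by
  refine ⟨kleinLabel ![0, 1, 2, 3, 4, 5, 6, 7] (by decide), isLabelledBy_closure F _ _ ?_ ?_⟩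
  · simp only [hK, true_and, Set.mem_insert_iff, Set.mem_singleton_iff, forall_eq_or_imp,
      forall_eq, kleinLabel, Equiv.ofBijective_apply]
    decide
  · have words : ∀ (x y : ZMod 2 × ZMod 2) (τ : Bool), ∃ (i : Fin 2) (j : Fin 2) (k : Fin 2) (l : Fin 2) (m : Fin 2), ∀ n,
        (klein8 ∘ ![0, 1, 2, 3, 4, 5, 6, 7]) (((c[1, 0] * c[2, 3] * c[4, 5] * c[6, 7] : Equiv.Perm (Fin 8)) ^ i.1 *
        (c[1, 3] * c[2, 0] * c[4, 6] * c[5, 7] : Equiv.Perm (Fin 8)) ^ j.1 *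
        (c[4, 5] * c[6, 7] : Equiv.Perm (Fin 8)) ^ k.1 *
        (c[4, 6] * c[5, 7] : Equiv.Perm (Fin 8)) ^ l.1 *
        (c[1, 5] * c[2, 6] * c[3, 7] * c[4, 0] : Equiv.Perm (Fin 8)) ^ m.1) n) =
        wreathAct x y τ ((klein8 ∘ ![0, 1, 2, 3, 4, 5, 6, 7]) n) := by
      decide
    intro x y τ _
    obtain ⟨i, j, k, l, m, h⟩ := words x y τ
    simp only [kleinLabel, Equiv.ofBijective_apply]
    refine ⟨_, ?_, h⟩
    refine mul_mem (mul_mem (mul_mem (mul_mem ?_ ?_) ?_) ?_) ?_ <;> refine pow_mem ?_ _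
    all_goals exact Subgroup.subset_closure (by simp)

end

/-! ### Classification by invariant characters of (ℤ/2)². -/

/-- The action of `G` on the two orbits `a V p`, `a V q` is `H`, for some labelling. -/
def OrbitsLabelledBy {V Y : Type*} (G : Type*) [Group G] [MulAction G Y] (a : V → Y → Y)
    (p q : Y) {n : ℕ} (H : Subgroup (Equiv.Perm (Fin n))) : Prop :=
  ∃ e : Fin n → Y, Function.Injective e ∧ (∀ k, ∃ v, e k = a v p ∨ e k = a v q) ∧
    IsLabelledBy G H e

theorem ZMod.two_prod_exists_addEquiv {c d : ZMod 2 × ZMod 2} (hc : c ≠ 0) (hd : d ≠ 0)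
    (hcd : c ≠ d) : ∃ θ : ZMod 2 × ZMod 2 ≃+ ZMod 2 × ZMod 2, θ (1, 0) = c ∧ θ (0, 1) = d := by
  let f : ZMod 2 × ZMod 2 →+ ZMod 2 × ZMod 2 :=
    { toFun := fun v => (v.1 * c.1 + v.2 * d.1, v.1 * c.2 + v.2 * d.2)
      map_zero' := by simp
      map_add' := fun v w => by ext <;> simp <;> ring }
  have hf : Function.Injective f := by
    change Function.Injective
      (fun v : ZMod 2 × ZMod 2 => (v.1 * c.1 + v.2 * d.1, v.1 * c.2 + v.2 * d.2))
    revert c d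
    decide
  exact ⟨AddEquiv.ofBijective f (Finite.injective_iff_bijective.1 hf), by simp [f], by simp [f]⟩

theorem ZMod.two_prod_add_self (x : ZMod 2 × ZMod 2) : x + x = 0 := by
  revert x; decide

namespace BlockFrame

variable {Y G : Type*} [Group G] [MulAction G Y]
  {a : ZMod 2 × ZMod 2 → Y → Y} {p q : Y} {z : ZMod 2 × ZMod 2}

theorem orbitsLabelledBy (F : BlockFrame G a p q z) {n : ℕ} {H : Subgroup (Equiv.Perm (Fin n))}
    (h : ∃ ρ, IsLabelledBy G H (label a p q ρ)) : OrbitsLabelledBy G a p q H := by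
  obtain ⟨ρ, hρ⟩ := h
  refine ⟨_, F.label_injective ρ, fun k => ⟨(ρ k).1, ?_⟩, hρ⟩
  unfold label
  cases (ρ k).2 <;> simp

theorem orbitsLabelledBy_of_comp (θ : ZMod 2 × ZMod 2 ≃+ ZMod 2 × ZMod 2)
    {n : ℕ} {H : Subgroup (Equiv.Perm (Fin n))}
    (h : OrbitsLabelledBy G (fun w => a (θ w)) p q H) : OrbitsLabelledBy G a p q H := by
  obtain ⟨e, he, h1, h2⟩ := h
  exact ⟨e, he, fun k => (h1 k).imp' θ fun _ h => h, h2⟩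

theorem orbitsLabelledBy_of_shift (F : BlockFrame G a p q z) {u : ZMod 2 × ZMod 2}
    {n : ℕ} {H : Subgroup (Equiv.Perm (Fin n))}
    (h : OrbitsLabelledBy G a p (a u q) H) : OrbitsLabelledBy G a p q H := by
  obtain ⟨e, he, h1, h2⟩ := h
  refine ⟨e, he, fun k => ?_, h2⟩
  obtain ⟨v, h | h⟩ := h1 k
  · exact ⟨v, .inl h⟩
  · exact ⟨v + u, .inr (by rw [h, F.add])⟩

/-- A linear form on `(ℤ/2)²` takes equal values at both translations induced by any element of
`G` preserving the blocks. -/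
def _root_.BlockInvariant (G : Type*) [Group G] [MulAction G Y]
    (a : ZMod 2 × ZMod 2 → Y → Y) (p q : Y) (χ : ZMod 2 × ZMod 2 →+ ZMod 2) : Prop :=
  ∀ x y, BlockRel G a p q x y → χ x = χ y

theorem orbitsLabelledBy_group8T3 (F : BlockFrame G a p q z)
    (hK : ∀ x y, BlockRel G a p q x y → y = x) (hz : z = 0) :
    OrbitsLabelledBy G a p q group8T3 := by
  subst hz
  refine F.orbitsLabelledBy (isLabelledBy_group8T3 F fun x y => ⟨hK x y, ?_⟩)
  rintro rfl
  obtain ⟨w, hw⟩ := F.rel_surj y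
  rwa [hK _ _ hw] at hw

theorem orbitsLabelledBy_group8T2 (F : BlockFrame G a p q z)
    (hK : ∀ x y, BlockRel G a p q x y → y = x) (hz : z ≠ 0) :
    OrbitsLabelledBy G a p q group8T2 := by
  obtain ⟨d, hd, hdz⟩ : ∃ d : ZMod 2 × ZMod 2, d ≠ 0 ∧ z ≠ d :=
    (show ∀ z : ZMod 2 × ZMod 2, ∃ d : ZMod 2 × ZMod 2, d ≠ 0 ∧ z ≠ d by decide) z
  obtain ⟨θ, hθ, -⟩ := ZMod.two_prod_exists_addEquiv hz hd hdz
  have F' := F.comp θ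
  rw [← hθ, θ.symm_apply_apply] at F'
  refine orbitsLabelledBy_of_comp θ (F'.orbitsLabelledBy (isLabelledBy_group8T2 F' fun x y => ?_))
  refine ⟨fun h => θ.injective (hK _ _ h), ?_⟩
  rintro rfl
  obtain ⟨w, hw⟩ := F.rel_surj (θ y)
  rwa [hK _ _ hw] at hw

/-- Without invariant characters the sums x + y over K span V. If (x, y) ∈ K, then (x, y) + (y, x)
is the diagonal pair of x + y, so K contains the diagonal; adding (x, x) to (x, y) then yields (0, x
+ y). Hence K is everything. -/
theorem orbitsLabelledBy_group8T18 (F : BlockFrame G a p q z)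
    (h : ∀ χ : ZMod 2 × ZMod 2 →+ ZMod 2, χ ≠ 0 → ¬ BlockInvariant G a p q χ) :
    OrbitsLabelledBy G a p q group8T18 := by
  have h2 := ZMod.two_prod_add_self
  have hχ : ∀ χ : ZMod 2 × ZMod 2 →+ ZMod 2, χ ≠ 0 → ∃ x y, BlockRel G a p q x y ∧
      χ (x + y) ≠ 0 := by
    intro χ hχ
    have := h χ hχ
    unfold BlockInvariant at this
    push Not at this
    obtain ⟨x, y, hK, hne⟩ := this
    refine ⟨x, y, hK, fun h0 => hne ?_⟩
    rw [map_add] at h0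
    exact (show ∀ i j : ZMod 2, i + j = 0 → i = j by decide) _ _ h0
  obtain ⟨x₁, y₁, k₁, n₁⟩ := hχ (.fst _ _) fun h => by simpa using DFunLike.congr_fun h (1, 0)
  obtain ⟨x₂, y₂, k₂, n₂⟩ := hχ (.snd _ _) fun h => by simpa using DFunLike.congr_fun h (0, 1)
  obtain ⟨x₃, y₃, k₃, n₃⟩ := hχ (.fst _ _ + .snd _ _) fun h => by
    simpa using DFunLike.congr_fun h (1, 0)
  have span : ∀ w₁ w₂ w₃ : ZMod 2 × ZMod 2, w₁.1 ≠ 0 → w₂.2 ≠ 0 → w₃.1 + w₃.2 ≠ 0 →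
      ∀ v, ∃ i j k : Fin 2, v = i.1 • w₁ + j.1 • w₂ + k.1 • w₃ := by decide
  have hsmul : ∀ {x y} (n : ℕ), BlockRel G a p q x y → BlockRel G a p q (n • x) (n • y) := by
    intro x y n hxy
    induction n with
    | zero =>
      rw [zero_smul, zero_smul, ← h2 z]
      exact F.rel_add F.rel_self F.rel_self
    | succ n ih =>
      rw [succ_nsmul, succ_nsmul]
      exact F.rel_add ih hxy
  have hsum : ∀ v, ∃ x y, BlockRel G a p q x y ∧ x + y = v := by
    intro v
    obtain ⟨i, j, k, rfl⟩ := span (x₁ + y₁) (x₂ + y₂) (x₃ + y₃) n₁ n₂ n₃ v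
    refine ⟨_, _, F.rel_add (F.rel_add (hsmul i.1 k₁) (hsmul j.1 k₂)) (hsmul k.1 k₃), ?_⟩
    simp only [smul_add]
    abel
  have hdiag : ∀ v, BlockRel G a p q v v := by
    intro v
    obtain ⟨x, y, hK, rfl⟩ := hsum v
    have := F.rel_add hK (F.rel_swap hK)
    rwa [add_comm y x] at this
  have hzero : ∀ v, BlockRel G a p q 0 v := by
    intro v
    obtain ⟨x, y, hK, rfl⟩ := hsum v
    have := F.rel_add hK (hdiag x)
    rwa [h2, add_comm y x] at this
  -- Moving the second base point by the pair (0, z) replaces z by 0 + z + z = 0.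
  have F' := F.shift (hzero z)
  rw [zero_add, h2] at F'
  refine F.orbitsLabelledBy_of_shift (F'.orbitsLabelledBy (isLabelledBy_group8T18 F' ?_))
  intro x y
  rw [F.rel_shift]
  have := F.rel_add (hdiag x) (hzero (x + y))
  rwa [add_zero, ← add_assoc, h2, zero_add] at this

theorem _root_.ZMod.two_prod_hom_apply (χ : ZMod 2 × ZMod 2 →+ ZMod 2) (x : ZMod 2 × ZMod 2) :
    χ x = x.1 * χ (1, 0) + x.2 * χ (0, 1) := by
  have h2 : ∀ i : ZMod 2, i = 0 ∨ i = 1 := by decide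
  obtain ⟨i, j⟩ := x
  rcases h2 i with rfl | rfl <;> rcases h2 j with rfl | rfl <;> simp [← map_add]
  exact map_zero χ

/-- The kernel of a nonzero linear form on `(ℤ/2)²`. -/
theorem _root_.ZMod.two_prod_exists_ker {χ : ZMod 2 × ZMod 2 →+ ZMod 2} (hχ : χ ≠ 0) :
    ∃ c ≠ 0, ∀ x, χ x = 0 ↔ x = 0 ∨ x = c := by
  have hne : ¬ (χ (1, 0) = 0 ∧ χ (0, 1) = 0) := by
    rintro ⟨h1, h2⟩
    exact hχ (AddMonoidHom.ext fun x => by rw [ZMod.two_prod_hom_apply, h1, h2]; simp)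
  have key : ∀ i j : ZMod 2, ¬ (i = 0 ∧ j = 0) → ∃ c : ZMod 2 × ZMod 2, c ≠ 0 ∧
      ∀ x : ZMod 2 × ZMod 2, x.1 * i + x.2 * j = 0 ↔ x = 0 ∨ x = c := by decide
  obtain ⟨c, hc, h⟩ := key _ _ hne
  exact ⟨c, hc, fun x => by rw [ZMod.two_prod_hom_apply, h]⟩

theorem _root_.ZMod.two_prod_hom_comp_eq_iff {χ : ZMod 2 × ZMod 2 →+ ZMod 2}
    {c d : ZMod 2 × ZMod 2} (hc : χ c = 0) (hd : χ d ≠ 0)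
    {θ : ZMod 2 × ZMod 2 ≃+ ZMod 2 × ZMod 2} (hθc : θ (1, 0) = c) (hθd : θ (0, 1) = d)
    (x y : ZMod 2 × ZMod 2) : χ (θ x) = χ (θ y) ↔ x.2 = y.2 := by
  have h : ∀ x, χ (θ x) = x.2 := by
    intro x
    have h1 : χ d = 1 := (show ∀ i : ZMod 2, i ≠ 0 → i = 1 by decide) _ hd
    have := ZMod.two_prod_hom_apply (χ.comp θ.toAddMonoidHom) x
    simpa [hθc, hθd, hc, h1] using this
  rw [h, h]

/-- In the presence of an invariant form, the pairs of translations are either all pairs on which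
the form takes equal values, or the graph of an involution. -/
theorem rel_iff_of_blockInvariant (F : BlockFrame G a p q z) {χ : ZMod 2 × ZMod 2 →+ ZMod 2}
    (hχ : χ ≠ 0) (h : BlockInvariant G a p q χ) {c : ZMod 2 × ZMod 2} (hc : c ≠ 0)
    (hc' : BlockRel G a p q 0 c) (x y : ZMod 2 × ZMod 2) :
    BlockRel G a p q x y ↔ χ x = χ y := by
  refine ⟨h x y, fun hxy => ?_⟩
  obtain ⟨d, hd, hker⟩ := ZMod.two_prod_exists_ker hχ
  have hcd : c = d := by
    have := (hker c).1 (by rw [← h _ _ hc', map_zero])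
    simpa [hc] using this
  subst hcd
  -- Some (x, w) lies in K; `w` and `y` differ by an element of the kernel {0, c}, and the pair (0,
  -- c) makes up for the difference.
  obtain ⟨w, hw⟩ := F.rel_surj x
  have : χ (w - y) = 0 := by rw [map_sub, ← h _ _ hw, hxy, sub_self]
  rcases (hker _).1 this with h0 | h0
  · rwa [sub_eq_zero.1 h0] at hw
  · have := F.rel_add hw hc'
    rwa [add_zero, ← h0, add_sub, ZMod.two_prod_add_self, zero_sub,
      neg_eq_of_add_eq_zero_left (ZMod.two_prod_add_self y)] at this

/-- As χ(z) ≠ 0, the generator c of ker χ and z form a basis. An off-diagonal pair of K is (x, x +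
c) for some x; adding (z, z) and exchanging coordinates turns it into (0, c), so K is as large as χ
permits. Here z cannot be normalised to 0. -/
theorem orbitsLabelledBy_group8T10 (F : BlockFrame G a p q z) {χ : ZMod 2 × ZMod 2 →+ ZMod 2}
    (h : BlockInvariant G a p q χ) (hz : χ z ≠ 0) (hd : ¬ ∀ x y, BlockRel G a p q x y → y = x) :
    OrbitsLabelledBy G a p q group8T10 := by
  have hχ : χ ≠ 0 := by rintro rfl; exact hz rfl
  obtain ⟨c, hc, hker⟩ := ZMod.two_prod_exists_ker hχ
  have hcz : c ≠ z := by rintro rfl; exact hz ((hker _).2 (.inr rfl))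
  have hz0 : z ≠ 0 := by rintro rfl; exact hz (map_zero _)
  have hc' : BlockRel G a p q 0 c := by
    push Not at hd
    obtain ⟨x, y, hxy, hne⟩ := hd
    have hxc : y = x + c := by
      have : χ (y - x) = 0 := by rw [map_sub, h _ _ hxy, sub_self]
      rcases (hker _).1 this with h | h
      · exact absurd (sub_eq_zero.1 h) hne
      · rw [← h]; abel
    subst hxc
    have key : ∀ c z x : ZMod 2 × ZMod 2, c ≠ 0 → z ≠ 0 → c ≠ z →
        x = 0 ∨ x = c ∨ x = z ∨ x = z + c := by
      set_option synthInstance.maxSize 1000 in decide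
    have h2 := ZMod.two_prod_add_self
    have hzz := F.rel_self
    rcases key c z x hc hz0 hcz with rfl | rfl | rfl | rfl
    · simpa using hxy
    · rw [h2] at hxy; exact F.rel_swap hxy
    · have := F.rel_add hxy hzz
      rwa [h2, add_right_comm, h2, zero_add] at this
    · have := F.rel_add hxy hzz
      rw [add_assoc z c c, h2, add_zero, h2, add_right_comm, h2, zero_add] at this
      exact F.rel_swap this
  obtain ⟨θ, hθc, hθz⟩ := ZMod.two_prod_exists_addEquiv hc hz0 hcz
  have F' := F.comp θ
  rw [← hθz, θ.symm_apply_apply] at F'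
  refine orbitsLabelledBy_of_comp θ (F'.orbitsLabelledBy (isLabelledBy_group8T10 F' fun x y => ?_))
  refine (F.rel_iff_of_blockInvariant hχ h hc hc' _ _).trans ?_
  exact ZMod.two_prod_hom_comp_eq_iff ((hker c).2 (.inr rfl)) hz hθc hθz x y

theorem orbitsLabelledBy_group8T9 (F : BlockFrame G a p q z) {χ : ZMod 2 × ZMod 2 →+ ZMod 2}
    (hχ : χ ≠ 0) (h : BlockInvariant G a p q χ) (hz : χ z = 0) {c : ZMod 2 × ZMod 2} (hc : c ≠ 0)
    (hc' : BlockRel G a p q 0 c) :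
    OrbitsLabelledBy G a p q group8T9 := by
  have hK := F.rel_iff_of_blockInvariant hχ h hc hc'
  obtain ⟨d, hd⟩ : ∃ d, χ d ≠ 0 := by
    by_contra! h0
    exact hχ (AddMonoidHom.ext h0)
  have hχc : χ c = 0 := by rw [← h _ _ hc', map_zero]
  have hcd : c ≠ d := by rintro rfl; exact hd hχc
  have hd0 : d ≠ 0 := by rintro rfl; exact hd (map_zero _)
  obtain ⟨θ, hθc, hθd⟩ := ZMod.two_prod_exists_addEquiv hc hd0 hcd
  -- Because χ(z) = 0, the pair (0, z) lies in K and can be used to make z vanish.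
  have F₁ := F.shift ((hK 0 z).2 (by rw [hz, map_zero]))
  rw [zero_add, ZMod.two_prod_add_self] at F₁
  have F' := F₁.comp θ
  rw [map_zero] at F'
  refine F.orbitsLabelledBy_of_shift (orbitsLabelledBy_of_comp θ (F'.orbitsLabelledBy
    (isLabelledBy_group8T9 F' fun x y => ?_)))
  refine (F.rel_shift _ _ _).trans ((hK _ _).trans ?_)
  exact ZMod.two_prod_hom_comp_eq_iff hχc hd hθc hθd x y

/-- Here K is the graph of a nontrivial involution preserving χ: it fixes the generator c of ker χ
and moves some d to c + d. In the basis c, d it is a transvection. -/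
theorem orbitsLabelledBy_group8T4 (F : BlockFrame G a p q z) {χ : ZMod 2 × ZMod 2 →+ ZMod 2}
    (hχ : χ ≠ 0) (h : BlockInvariant G a p q χ) (hd : ¬ ∀ x y, BlockRel G a p q x y → y = x)
    (hc' : ∀ c, BlockRel G a p q 0 c → c = 0) :
    OrbitsLabelledBy G a p q group8T4 := by
  have h2 := ZMod.two_prod_add_self
  obtain ⟨c, hc, hker⟩ := ZMod.two_prod_exists_ker hχ
  have uniq : ∀ {x y y'}, BlockRel G a p q x y → BlockRel G a p q x y' → y = y' := by
    intro x y y' hy hy'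
    have := F.rel_add hy hy'
    rw [h2] at this
    rw [← add_zero y, ← h2 y', ← add_assoc, hc' _ this, zero_add]
  have zero : BlockRel G a p q 0 0 := by
    have := F.rel_add F.rel_self F.rel_self
    rwa [h2] at this
  have hcc : BlockRel G a p q c c := by
    obtain ⟨w, hw⟩ := F.rel_surj c
    have : χ w = 0 := by rw [← h _ _ hw]; exact (hker c).2 (.inr rfl)
    rcases (hker w).1 this with rfl | rfl
    · exact absurd (hc' _ (F.rel_swap hw)) hc
    · exact hw
  obtain ⟨d, hdd⟩ : ∃ d, BlockRel G a p q d (c + d) := by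
    push Not at hd
    obtain ⟨x, y, hxy, hne⟩ := hd
    refine ⟨x, ?_⟩
    have : χ (y - x) = 0 := by rw [map_sub, h _ _ hxy, sub_self]
    rcases (hker _).1 this with h | h
    · exact absurd (sub_eq_zero.1 h) hne
    · rwa [← h, sub_add_cancel]
  have hd0 : d ≠ 0 := by
    rintro rfl
    exact hc (hc' _ (by simpa using hdd))
  have hcd : c ≠ d := by
    rintro rfl
    rw [h2] at hdd
    exact hc (hc' _ (F.rel_swap hdd))
  obtain ⟨θ, hθc, hθd⟩ := ZMod.two_prod_exists_addEquiv hc hd0 hcd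
  -- Since (z, z) ∈ K, z is fixed by the involution, so it is 0 or c; in the second case the pair
  -- (d, c + d), of sum c, removes it.
  obtain ⟨u, u', hu, hu0⟩ : ∃ u u', BlockRel G a p q u u' ∧ u + u' + z = 0 := by
    by_cases hz : z = 0
    · exact ⟨0, 0, zero, by simp [hz]⟩
    · refine ⟨d, c + d, hdd, ?_⟩
      have hzz := F.rel_self
      have key : z = c ∨ z = d ∨ z = c + d :=
        (show ∀ c d z : ZMod 2 × ZMod 2, c ≠ 0 → d ≠ 0 → c ≠ d → z ≠ 0 →
          z = c ∨ z = d ∨ z = c + d by decide) c d z hc hd0 hcd hz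
      have key : z = c := by
        rcases key with h | h | h
        · exact h
        · rw [h] at hzz
          exact absurd (add_eq_right.1 (uniq hdd hzz)) hc
        · rw [h] at hzz
          have := uniq (F.rel_swap hdd) hzz
          exact absurd (right_eq_add.1 this) hc
      calc d + (c + d) + z = (d + d) + (c + c) := by rw [key]; abel
        _ = 0 := by rw [h2, h2, add_zero]
  have F₁ := F.shift hu
  rw [hu0] at F₁
  have F' := F₁.comp θ
  rw [map_zero] at F'
  refine F.orbitsLabelledBy_of_shift (orbitsLabelledBy_of_comp θ (F'.orbitsLabelledBy
    (isLabelledBy_group8T4 F' fun x y => ?_)))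
  refine (F.rel_shift _ _ _).trans ?_
  have hθ : ∀ x, BlockRel G a p q (θ x) (θ (x.1 + x.2, x.2)) := by
    intro x
    have hx : x = 0 ∨ x = (1, 0) ∨ x = (0, 1) ∨ x = (1, 0) + (0, 1) := by
      revert x; decide
    have hθcd : θ (1, 1) = c + d := by rw [← hθc, ← hθd, ← map_add]; rfl
    rcases hx with rfl | rfl | rfl | rfl
    · simpa [show θ (0, 0) = 0 from map_zero θ] using zero
    · simpa [hθc] using hcc
    · simpa [hθd, hθcd] using hdd
    · have : ((1 + 1, 1) : ZMod 2 × ZMod 2) = (0, 1) := by decide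
      simpa [hθcd, this, hθd] using F.rel_swap hdd
  constructor
  · intro hxy
    exact θ.injective (uniq hxy (hθ x))
  · rintro rfl
    exact hθ x

end BlockFrame

/-! ### Sign changes, inversions and semi-invariant functions. -/

section signInv

variable {L : Type*} [Field L]

/-- The sign `±1` in `L` attached to an element of `ℤ/2`. -/
def zmodSign (L : Type*) [Field L] (i : ZMod 2) : L := if i = 0 then 1 else -1

@[simp] theorem zmodSign_zero : zmodSign L 0 = 1 := by simp [zmodSign]

@[simp] theorem zmodSign_one : zmodSign L 1 = -1 := by simp [zmodSign]

theorem ZMod.two_eq_zero_or_one (i : ZMod 2) : i = 0 ∨ i = 1 := by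
  revert i; decide

theorem zmodSign_add (i j : ZMod 2) : zmodSign L (i + j) = zmodSign L i * zmodSign L j := by
  rcases i.two_eq_zero_or_one with rfl | rfl <;> rcases j.two_eq_zero_or_one with rfl | rfl <;>
    simp [show (1 : ZMod 2) + 1 = 0 by decide]

theorem zmodSign_mul_self (i : ZMod 2) : zmodSign L i * zmodSign L i = 1 := by
  rcases i.two_eq_zero_or_one with rfl | rfl <;> simp

theorem zmodSign_eq_one_iff [CharZero L] {i : ZMod 2} : zmodSign L i = 1 ↔ i = 0 := by
  rcases i.two_eq_zero_or_one with rfl | rfl <;> simp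
  norm_num

@[simp] theorem map_zmodSign {F : Type*} [FunLike F L L] [RingHomClass F L L] (φ : F)
    (i : ZMod 2) : φ (zmodSign L i) = zmodSign L i := by
  rcases i.two_eq_zero_or_one with rfl | rfl <;> simp

/-- The action of `(ℤ/2)²` by change of sign and inversion. -/
def signInv (v : ZMod 2 × ZMod 2) (y : L) : L :=
  zmodSign L v.1 * if v.2 = 0 then y else y⁻¹

theorem signInv_add (v w : ZMod 2 × ZMod 2) (y : L) :
    signInv (v + w) y = signInv v (signInv w y) := by
  obtain ⟨i, j⟩ := v
  obtain ⟨k, l⟩ := w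
  rcases i.two_eq_zero_or_one with rfl | rfl <;> rcases j.two_eq_zero_or_one with rfl | rfl <;>
  rcases k.two_eq_zero_or_one with rfl | rfl <;> rcases l.two_eq_zero_or_one with rfl | rfl <;>
    simp [signInv, show (1 : ZMod 2) + 1 = 0 by decide, inv_neg]

theorem signInv_zero (y : L) : signInv 0 y = y := by simp [signInv]

theorem map_signInv {F : Type*} [FunLike F L L] [RingHomClass F L L] (φ : F)
    (v : ZMod 2 × ZMod 2) (y : L) : φ (signInv v y) = signInv v (φ y) := by
  obtain ⟨i, j⟩ := v
  rcases j.two_eq_zero_or_one with rfl | rfl <;> simp [signInv]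

/-- The function `τ` commutes with endomorphisms, and changes sign under the action of `(ℤ/2)²` by
means of the character `χ`. -/
structure IsSemiInvariant (χ : ZMod 2 × ZMod 2 →+ ZMod 2) (τ : L → L) : Prop where
  act : ∀ v y, τ (signInv v y) = zmodSign L (χ v) * τ y
  map : ∀ (φ : L →+* L) y, φ (τ y) = τ (φ y)

theorem isSemiInvariant_add_inv :
    IsSemiInvariant (AddMonoidHom.fst _ _) (fun y : L => y + y⁻¹) where
  act v y := by
    obtain ⟨i, j⟩ := v
    rcases i.two_eq_zero_or_one with rfl | rfl <;> rcases j.two_eq_zero_or_one with rfl | rfl <;>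
      simp [signInv, inv_neg] <;> ring
  map φ y := by simp

theorem isSemiInvariant_sub_inv :
    IsSemiInvariant (AddMonoidHom.fst _ _ + AddMonoidHom.snd _ _) (fun y : L => y - y⁻¹) where
  act v y := by
    obtain ⟨i, j⟩ := v
    rcases i.two_eq_zero_or_one with rfl | rfl <;> rcases j.two_eq_zero_or_one with rfl | rfl <;>
      simp [signInv, inv_neg, show (1 : ZMod 2) + 1 = 0 by decide] <;> ring
  map φ y := by simp

theorem isSemiInvariant_sq_sub_inv_sq :
    IsSemiInvariant (AddMonoidHom.snd _ _) (fun y : L => y ^ 2 - (y⁻¹) ^ 2) where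
  act v y := by
    obtain ⟨i, j⟩ := v
    rcases i.two_eq_zero_or_one with rfl | rfl <;> rcases j.two_eq_zero_or_one with rfl | rfl <;>
      simp [signInv, inv_neg]
  map φ y := by simp

end signInv

/-- Every nonzero linear form on `(ℤ/2)²` is one of three. -/
theorem ZMod.two_prod_hom_cases {χ : ZMod 2 × ZMod 2 →+ ZMod 2} (hχ : χ ≠ 0) :
    χ = .fst _ _ ∨ χ = .fst _ _ + .snd _ _ ∨ χ = .snd _ _ := by
  rcases (χ (1, 0)).two_eq_zero_or_one with h1 | h1 <;>
    rcases (χ (0, 1)).two_eq_zero_or_one with h2 | h2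
  · exact absurd (AddMonoidHom.ext fun x => by rw [ZMod.two_prod_hom_apply, h1, h2]; simp) hχ
  · exact .inr (.inr (AddMonoidHom.ext fun x => by rw [ZMod.two_prod_hom_apply, h1, h2]; simp))
  · exact .inl (AddMonoidHom.ext fun x => by rw [ZMod.two_prod_hom_apply, h1, h2]; simp)
  · exact .inr (.inl (AddMonoidHom.ext fun x => by rw [ZMod.two_prod_hom_apply, h1, h2]; simp))

/-! ### Roots of the octic and the three forms on them. -/

/-- Representatives `r`, `s` of the roots of `x⁸ + a x⁶ + b x⁴ + a x² + 1` under change of sign and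
inversion. -/
structure OcticRoots {L : Type*} [Field L] (a b : ℚ) (r s : L) : Prop where
  ne_zero : r ≠ 0
  ne_zero' : s ≠ 0
  pow_four : r ^ 4 ≠ 1
  pow_four' : s ^ 4 ≠ 1
  sum : r ^ 2 + (r⁻¹) ^ 2 + (s ^ 2 + (s⁻¹) ^ 2) = -a
  prod : (r ^ 2 + (r⁻¹) ^ 2) * (s ^ 2 + (s⁻¹) ^ 2) = b - 2
  ne : r ^ 2 + (r⁻¹) ^ 2 ≠ s ^ 2 + (s⁻¹) ^ 2

/-- Clearing denominators, the difference of the two sides factors as (x² - y²)(x²y² - 1). -/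
theorem exists_signInv_of_sq_add_inv_sq_eq {L : Type*} [Field L] {x y : L} (hx : x ≠ 0)
    (hy : y ≠ 0) (h : x ^ 2 + (x⁻¹) ^ 2 = y ^ 2 + (y⁻¹) ^ 2) : ∃ v, x = signInv v y := by
  have h1 : (x ^ 2 - y ^ 2) * (x ^ 2 * y ^ 2 - 1) = 0 := by
    field_simp at h
    linear_combination h
  rcases mul_eq_zero.1 h1 with h1 | h1
  · rcases sq_eq_sq_iff_eq_or_eq_neg.1 (sub_eq_zero.1 h1) with h1 | h1
    · exact ⟨(0, 0), by simp [signInv, h1]⟩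
    · exact ⟨(1, 0), by simp [signInv, h1]⟩
  · have : (x * y) ^ 2 = 1 ^ 2 := by linear_combination h1
    rcases sq_eq_sq_iff_eq_or_eq_neg.1 this with h1 | h1
    · exact ⟨(0, 1), by simp [signInv, eq_inv_of_mul_eq_one_left h1]⟩
    · refine ⟨(1, 1), ?_⟩
      have : x = - y⁻¹ := by field_simp; linear_combination h1
      simp [signInv, this]

theorem sq_add_inv_sq_signInv {L : Type*} [Field L] (v : ZMod 2 × ZMod 2) (y : L) :
    (signInv v y) ^ 2 + ((signInv v y)⁻¹) ^ 2 = y ^ 2 + (y⁻¹) ^ 2 := by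
  obtain ⟨i, j⟩ := v
  rcases i.two_eq_zero_or_one with rfl | rfl <;> rcases j.two_eq_zero_or_one with rfl | rfl <;>
    simp [signInv, inv_neg, add_comm]

namespace OcticRoots

variable {L : Type*} [Field L] {a b : ℚ} {r s : L}

/-- A fixed point of a nontrivial element would satisfy y = -y, y² = 1 or y² = -1. -/
theorem signInv_injective [CharZero L] {y : L} (hy : y ≠ 0) (h4 : y ^ 4 ≠ 1) (v w : ZMod 2 × ZMod 2)
    (h : signInv v y = signInv w y) : v = w := by
  suffices h0 : ∀ v, signInv v y = y → v = 0 by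
    have : signInv (w + v) y = y := by
      rw [signInv_add, h, ← signInv_add, ZMod.two_prod_add_self, signInv_zero]
    have := h0 _ this
    rw [← add_zero v, ← ZMod.two_prod_add_self w, add_comm w w, ← add_assoc, add_comm v w, this,
      zero_add]
  rintro ⟨i, j⟩ h
  rcases i.two_eq_zero_or_one with rfl | rfl <;> rcases j.two_eq_zero_or_one with rfl | rfl <;>
    simp [signInv] at h
  · rfl
  · exfalso
    apply h4
    field_simp at h
    rw [show y ^ 4 = (y ^ 2) ^ 2 by ring, ← h, one_pow]
  · exact absurd (self_eq_neg.1 h.symm) hy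
  · exfalso
    apply h4
    field_simp at h
    rw [show y ^ 4 = (y ^ 2) ^ 2 by ring, ← h]; norm_num

theorem symm (R : OcticRoots a b r s) : OcticRoots a b s r where
  ne_zero := R.ne_zero'
  ne_zero' := R.ne_zero
  pow_four := R.pow_four'
  pow_four' := R.pow_four
  sum := by rw [add_comm, R.sum]
  prod := by rw [mul_comm, R.prod]
  ne := R.ne.symm

/-- Changing the second representative. -/
theorem of_sq_add_inv_sq_eq (R : OcticRoots a b r s) {t : L} (ht : t ≠ 0)
    (h : t ^ 2 + (t⁻¹) ^ 2 = s ^ 2 + (s⁻¹) ^ 2) : OcticRoots a b r t where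
  ne_zero := R.ne_zero
  ne_zero' := ht
  pow_four := R.pow_four
  pow_four' := by
    intro h4
    apply R.pow_four'
    obtain ⟨v, rfl⟩ := exists_signInv_of_sq_add_inv_sq_eq R.ne_zero' ht h.symm
    obtain ⟨i, j⟩ := v
    rcases i.two_eq_zero_or_one with rfl | rfl <;> rcases j.two_eq_zero_or_one with rfl | rfl <;>
      simp [signInv, Even.neg_pow (show Even 4 by decide), h4]
  sum := by rw [h, R.sum]
  prod := by rw [h, R.prod]
  ne := by rw [h]; exact R.ne

variable [Algebra ℚ L] [CharZero L]

/-- Automorphisms permute the two roots of the rational quadratic t² + at + (b - 2). -/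
theorem map_eq_or (R : OcticRoots a b r s) (g : L ≃ₐ[ℚ] L) :
    g (r ^ 2 + (r⁻¹) ^ 2) = r ^ 2 + (r⁻¹) ^ 2 ∨ g (r ^ 2 + (r⁻¹) ^ 2) = s ^ 2 + (s⁻¹) ^ 2 := by
  have h1 := congrArg g R.sum
  have h2 := congrArg g R.prod
  have h3 := R.sum
  have h4 := R.prod
  rw [map_add, map_neg, map_ratCast] at h1
  rw [map_mul, map_sub, map_ratCast, map_ofNat] at h2
  generalize r ^ 2 + (r⁻¹) ^ 2 = u at *
  generalize s ^ 2 + (s⁻¹) ^ 2 = v at *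
  have : (g u - u) * (g u - v) = 0 := by linear_combination g u * h1 - h2 - g u * h3 + h4
  rcases mul_eq_zero.1 this with h | h
  · exact .inl (sub_eq_zero.1 h)
  · exact .inr (sub_eq_zero.1 h)

theorem exists_smul (R : OcticRoots a b r s) (g : L ≃ₐ[ℚ] L) :
    (∃ x, g • r = signInv x r) ∨ ∃ x, g • r = signInv x s := by
  have hg : g r ≠ 0 := by simpa using R.ne_zero
  refine (R.map_eq_or g).imp ?_ ?_ <;> intro h <;>
    simp only [map_add, map_pow, map_inv₀] at h
  · exact exists_signInv_of_sq_add_inv_sq_eq hg R.ne_zero h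
  · exact exists_signInv_of_sq_add_inv_sq_eq hg R.ne_zero' h

/-- An automorphism interchanging the two blocks gives rise to a `PreBlockFrame`. -/
theorem preBlockFrame (R : OcticRoots a b r s) {γ : L ≃ₐ[ℚ] L} (hγ : γ r = s) :
    ∃ z, PreBlockFrame (L ≃ₐ[ℚ] L) signInv r s z := by
  have h1 : γ (s ^ 2 + (s⁻¹) ^ 2) ≠ s ^ 2 + (s⁻¹) ^ 2 := by
    intro h
    have h' : γ (r ^ 2 + (r⁻¹) ^ 2) = s ^ 2 + (s⁻¹) ^ 2 := by simp [hγ]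
    exact R.ne (γ.injective (h'.trans h.symm))
  obtain ⟨z, hz⟩ : ∃ z, γ • s = signInv z r := by
    rcases R.symm.exists_smul γ with ⟨x, hx⟩ | h
    · exfalso
      apply h1
      have := sq_add_inv_sq_signInv x s
      rw [← hx] at this
      simpa using this
    · exact h
  exact ⟨z, {
    add := signInv_add
    zero := signInv_zero
    smul := fun g v y => map_signInv g v y
    inj := signInv_injective R.ne_zero R.pow_four
    disj := fun v w h => R.ne (by
      rw [← sq_add_inv_sq_signInv v r, h, sq_add_inv_sq_signInv])
    cover := R.exists_smul
    swap := ⟨γ, hγ, hz⟩ }⟩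

end OcticRoots

/-- A semi-invariant function on the roots, with the square `N` of the product and the sum `M` of
the squares of its values at the two representatives. -/
structure OcticForm {L : Type*} [Field L] (r s : L) (χ : ZMod 2 × ZMod 2 →+ ZMod 2) (τ : L → L)
    (N M : ℚ) : Prop extends IsSemiInvariant χ τ where
  ne_zero : τ r ≠ 0
  ne_zero' : τ s ≠ 0
  norm : (τ r * τ s) ^ 2 = N
  trace : τ r ^ 2 + τ s ^ 2 = M

namespace OcticRoots

variable {L : Type*} [Field L] [CharZero L] {a b : ℚ} {r s : L}

/-- The squares of the values are u + 2 and v + 2, so the constants follow from u + v = -a and uv =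
b - 2. For y - y⁻¹ they are u - 2 and v - 2, and y² - y⁻² is the product of these two forms. -/
theorem form_add_inv (R : OcticRoots a b r s) :
    OcticForm r s (.fst _ _) (fun y => y + y⁻¹) (b + 2 - 2 * a) (4 - a) where
  toIsSemiInvariant := isSemiInvariant_add_inv
  ne_zero h := R.pow_four (by
    have := R.ne_zero
    field_simp at h
    linear_combination (r ^ 2 - 1) * h)
  ne_zero' h := R.pow_four' (by
    have := R.ne_zero'
    field_simp at h
    linear_combination (s ^ 2 - 1) * h)
  norm := by
    have h1 := R.sum
    have h2 := R.prod
    have h3 := mul_inv_cancel₀ R.ne_zero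
    have h4 := mul_inv_cancel₀ R.ne_zero'
    push_cast
    generalize r⁻¹ = r' at *
    generalize s⁻¹ = s' at *
    have e1 : (r + r') ^ 2 = r ^ 2 + r' ^ 2 + 2 := by linear_combination 2 * h3
    have e2 : (s + s') ^ 2 = s ^ 2 + s' ^ 2 + 2 := by linear_combination 2 * h4
    rw [mul_pow, e1, e2]
    linear_combination h2 + 2 * h1
  trace := by
    have h1 := R.sum
    have h3 := mul_inv_cancel₀ R.ne_zero
    have h4 := mul_inv_cancel₀ R.ne_zero'
    push_cast
    linear_combination h1 + 2 * h3 + 2 * h4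

theorem form_sub_inv (R : OcticRoots a b r s) :
    OcticForm r s (.fst _ _ + .snd _ _) (fun y => y - y⁻¹) (b + 2 + 2 * a) (-4 - a) where
  toIsSemiInvariant := isSemiInvariant_sub_inv
  ne_zero h := R.pow_four (by
    have := R.ne_zero
    field_simp at h
    linear_combination (r ^ 2 + 1) * h)
  ne_zero' h := R.pow_four' (by
    have := R.ne_zero'
    field_simp at h
    linear_combination (s ^ 2 + 1) * h)
  norm := by
    have h1 := R.sum
    have h2 := R.prod
    have h3 := mul_inv_cancel₀ R.ne_zero
    have h4 := mul_inv_cancel₀ R.ne_zero'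
    push_cast
    generalize r⁻¹ = r' at *
    generalize s⁻¹ = s' at *
    have e1 : (r - r') ^ 2 = r ^ 2 + r' ^ 2 - 2 := by linear_combination -2 * h3
    have e2 : (s - s') ^ 2 = s ^ 2 + s' ^ 2 - 2 := by linear_combination -2 * h4
    rw [mul_pow, e1, e2]
    linear_combination h2 - 2 * h1
  trace := by
    have h1 := R.sum
    have h3 := mul_inv_cancel₀ R.ne_zero
    have h4 := mul_inv_cancel₀ R.ne_zero'
    push_cast
    linear_combination h1 - 2 * h3 - 2 * h4

theorem form_sq_sub_inv_sq (R : OcticRoots a b r s) :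
    OcticForm r s (.snd _ _) (fun y => y ^ 2 - (y⁻¹) ^ 2)
      ((b + 2 - 2 * a) * (b + 2 + 2 * a)) (a ^ 2 - 2 * b - 4) where
  toIsSemiInvariant := isSemiInvariant_sq_sub_inv_sq
  ne_zero h := by
    refine mul_ne_zero R.form_add_inv.ne_zero R.form_sub_inv.ne_zero ?_
    linear_combination h
  ne_zero' h := by
    refine mul_ne_zero R.form_add_inv.ne_zero' R.form_sub_inv.ne_zero' ?_
    linear_combination h
  norm := by
    have h1 := R.form_add_inv.norm
    have h2 := R.form_sub_inv.norm
    push_cast at h1 h2 ⊢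
    rw [← h1, ← h2]
    ring
  trace := by
    have h1 := R.sum
    have h2 := R.prod
    have h3 := mul_inv_cancel₀ R.ne_zero
    have h4 := mul_inv_cancel₀ R.ne_zero'
    push_cast
    generalize r⁻¹ = r' at *
    generalize s⁻¹ = s' at *
    linear_combination (r ^ 2 + r' ^ 2 + (s ^ 2 + s' ^ 2) - a) * h1 - 2 * h2 -
      4 * (r * r' + 1) * h3 - 4 * (s * s' + 1) * h4

theorem disc_sq (R : OcticRoots a b r s) :
    (r ^ 2 + (r⁻¹) ^ 2 - (s ^ 2 + (s⁻¹) ^ 2)) ^ 2 = ((a ^ 2 - 4 * b + 8 : ℚ) : L) := by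
  push_cast
  linear_combination (r ^ 2 + r⁻¹ ^ 2 + (s ^ 2 + s⁻¹ ^ 2) - a) * R.sum - 4 * R.prod

end OcticRoots

theorem IsSemiInvariant.apply_of_smul {L : Type*} [Field L] [Algebra ℚ L]
    {χ : ZMod 2 × ZMod 2 →+ ZMod 2} {τ : L → L} (h : IsSemiInvariant χ τ) {g : L ≃ₐ[ℚ] L}
    {x : ZMod 2 × ZMod 2} {y w : L} (hg : g • y = signInv x w) :
    g (τ y) = zmodSign L (χ x) * τ w := by
  rw [← h.act, ← hg]
  exact h.map (g : L →+* L) y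

/-! ### Invariance of characters and rational squares. -/

section Galois

variable {L : Type*} [Field L] [Algebra ℚ L]
  {a b : ℚ} {r s : L} {z : ZMod 2 × ZMod 2}

theorem exists_ratCast_eq_of_fixed [FiniteDimensional ℚ L] [IsGalois ℚ L] {ξ : L}
    (h : ∀ g : L ≃ₐ[ℚ] L, g ξ = ξ) : ∃ m : ℚ, ξ = m := by
  obtain ⟨m, hm⟩ := IntermediateField.mem_bot.1 ((IsGalois.mem_bot_iff_fixed ξ).2 h)
  exact ⟨m, by rw [← hm, eq_ratCast]⟩

namespace PreBlockFrame

/-- Any element exchanging the blocks is a chosen exchange γ times an element preserving them. -/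
theorem fixed (F : PreBlockFrame (L ≃ₐ[ℚ] L) signInv r s z) {ξ : L}
    (hK : ∀ x y, BlockRel (L ≃ₐ[ℚ] L) signInv r s x y → ∀ g : L ≃ₐ[ℚ] L,
      g • r = signInv x r → g • s = signInv y s → g ξ = ξ)
    (hγ : ∀ γ : L ≃ₐ[ℚ] L, γ • r = signInv 0 s → γ • s = signInv z r → γ ξ = ξ)
    (g : L ≃ₐ[ℚ] L) : g ξ = ξ := by
  rcases F.cases g with ⟨x, y, h1, h2⟩ | ⟨x, y, h1, h2⟩
  · exact hK x y ⟨g, h1, h2⟩ g h1 h2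
  · obtain ⟨γ, h3, h4⟩ := F.swap
    have h5 : (γ⁻¹ * g) • r = signInv x r := by
      rw [mul_smul, h1, inv_smul_eq_iff, F.smul, h3]
    have h6 : (γ⁻¹ * g) • s = signInv (y - z) s := by
      rw [mul_smul, h2, inv_smul_eq_iff, F.smul, h4, ← F.add, sub_add_cancel]
    have h7 := hK _ _ ⟨_, h5, h6⟩ _ h5 h6
    have h8 := congrArg γ h7
    rw [hγ γ (by rw [h3, F.zero]) h4] at h8
    calc g ξ = (γ * (γ⁻¹ * g)) ξ := by rw [mul_inv_cancel_left]
      _ = ξ := h8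

/-- The product of the values of a form at `r` and `s`. -/
theorem apply_prod {χ : ZMod 2 × ZMod 2 →+ ZMod 2} {τ : L → L}
    (hτ : IsSemiInvariant χ τ) {x y : ZMod 2 × ZMod 2} {g : L ≃ₐ[ℚ] L}
    (h : g • r = signInv x r ∧ g • s = signInv y s ∨ g • r = signInv x s ∧ g • s = signInv y r) :
    g (τ r * τ s) = zmodSign L (χ x + χ y) * (τ r * τ s) := by
  rcases h with ⟨h1, h2⟩ | ⟨h1, h2⟩ <;>
  · rw [map_mul, hτ.apply_of_smul h1, hτ.apply_of_smul h2, zmodSign_add]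
    ring

theorem _root_.apply_sq_add_inv_sq {x : ZMod 2 × ZMod 2} {y w : L} {g : L ≃ₐ[ℚ] L}
    (h : g • y = signInv x w) : g (y ^ 2 + (y⁻¹) ^ 2) = w ^ 2 + (w⁻¹) ^ 2 := by
  rw [← sq_add_inv_sq_signInv x w, ← h]
  simp

/-- A rational number `N` which is the square of the product of the values of a form with
character `χ` forces `χ` to be invariant if `N` is a square. -/
theorem blockInvariant_of_isSquare [CharZero L] (F : PreBlockFrame (L ≃ₐ[ℚ] L) signInv r s z)
    {χ : ZMod 2 × ZMod 2 →+ ZMod 2} {τ : L → L} {N M : ℚ} (hτ : OcticForm r s χ τ N M)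
    (hN : IsSquare N) : BlockInvariant (L ≃ₐ[ℚ] L) signInv r s χ ∧ χ z = 0 := by
  obtain ⟨m, rfl⟩ := hN
  have hm : τ r * τ s = m ∨ τ r * τ s = -m := by
    apply sq_eq_sq_iff_eq_or_eq_neg.1
    rw [hτ.norm]
    push_cast
    ring
  have hfix : ∀ g : L ≃ₐ[ℚ] L, g (τ r * τ s) = τ r * τ s := by
    intro g
    rcases hm with h | h <;> rw [h] <;> simp
  have hne : τ r * τ s ≠ 0 := mul_ne_zero hτ.ne_zero hτ.ne_zero'
  have key : ∀ {i : ZMod 2} {g : L ≃ₐ[ℚ] L}, g (τ r * τ s) = zmodSign L i * (τ r * τ s) →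
      i = 0 := by
    intro i g h
    rw [hfix] at h
    exact zmodSign_eq_one_iff.1 (mul_right_cancel₀ hne ((one_mul _).trans h)).symm
  constructor
  · rintro x y ⟨g, h1, h2⟩
    have := key (apply_prod hτ.toIsSemiInvariant (.inl ⟨h1, h2⟩))
    rw [← sub_eq_zero, ← this, CharTwo.sub_eq_add]
  · obtain ⟨γ, h1, h2⟩ := F.swap
    have := key (apply_prod (x := 0) hτ.toIsSemiInvariant
      (.inr ⟨by rw [h1, signInv_zero], h2⟩))
    simpa using this

theorem apply_prod_mul_disc {χ : ZMod 2 × ZMod 2 →+ ZMod 2} {τ : L → L}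
    (hτ : IsSemiInvariant χ τ) {x y : ZMod 2 × ZMod 2} {g : L ≃ₐ[ℚ] L}
    (h1 : g • r = signInv x r) (h2 : g • s = signInv y s) :
    g (τ r * τ s * (r ^ 2 + (r⁻¹) ^ 2 - (s ^ 2 + (s⁻¹) ^ 2))) = zmodSign L (χ x + χ y) *
      (τ r * τ s * (r ^ 2 + (r⁻¹) ^ 2 - (s ^ 2 + (s⁻¹) ^ 2))) := by
  rw [map_mul, apply_prod hτ (.inl ⟨h1, h2⟩), map_sub, apply_sq_add_inv_sq h1,
    apply_sq_add_inv_sq h2]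
  ring

theorem apply_prod_mul_disc_swap {χ : ZMod 2 × ZMod 2 →+ ZMod 2} {τ : L → L}
    (hτ : IsSemiInvariant χ τ) {x y : ZMod 2 × ZMod 2} {g : L ≃ₐ[ℚ] L}
    (h1 : g • r = signInv x s) (h2 : g • s = signInv y r) :
    g (τ r * τ s * (r ^ 2 + (r⁻¹) ^ 2 - (s ^ 2 + (s⁻¹) ^ 2))) = zmodSign L (χ x + χ y + 1) *
      (τ r * τ s * (r ^ 2 + (r⁻¹) ^ 2 - (s ^ 2 + (s⁻¹) ^ 2))) := by
  rw [map_mul, apply_prod hτ (.inr ⟨h1, h2⟩), map_sub, apply_sq_add_inv_sq h1,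
    apply_sq_add_inv_sq h2, zmodSign_add _ 1, zmodSign_one]
  ring

/-- The product τ(r)τ(s)(u - v) is rational, its square being N D. The factor u - v changes sign
exactly when the blocks are exchanged, which forces χ(z) = 1 instead of 0. -/
theorem blockInvariant_of_isSquare_mul [CharZero L] (R : OcticRoots a b r s)
    (F : PreBlockFrame (L ≃ₐ[ℚ] L) signInv r s z)
    {χ : ZMod 2 × ZMod 2 →+ ZMod 2} {τ : L → L} {N M : ℚ} (hτ : OcticForm r s χ τ N M)
    (hN : IsSquare (N * (a ^ 2 - 4 * b + 8))) :
    BlockInvariant (L ≃ₐ[ℚ] L) signInv r s χ ∧ χ z = 1 := by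
  obtain ⟨m, hm⟩ := hN
  have hne : τ r * τ s * (r ^ 2 + (r⁻¹) ^ 2 - (s ^ 2 + (s⁻¹) ^ 2)) ≠ 0 :=
    mul_ne_zero (mul_ne_zero hτ.ne_zero hτ.ne_zero') (sub_ne_zero.2 R.ne)
  have hdisc := R.disc_sq
  have hnorm := hτ.norm
  have h1 := fun {x y g} => apply_prod_mul_disc (r := r) (s := s) (x := x) (y := y) (g := g)
    hτ.toIsSemiInvariant
  have h2 := fun {x y g} => apply_prod_mul_disc_swap (r := r) (s := s) (x := x) (y := y) (g := g)
    hτ.toIsSemiInvariant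
  generalize r ^ 2 + (r⁻¹) ^ 2 - (s ^ 2 + (s⁻¹) ^ 2) = δ at *
  have hm : τ r * τ s * δ = m ∨ τ r * τ s * δ = -m := by
    apply sq_eq_sq_iff_eq_or_eq_neg.1
    rw [mul_pow, hnorm, hdisc, ← Rat.cast_mul, hm]
    push_cast
    ring
  have hfix : ∀ g : L ≃ₐ[ℚ] L, g (τ r * τ s * δ) = τ r * τ s * δ := by
    intro g
    rcases hm with h | h <;> rw [h] <;> simp
  have key : ∀ {i : ZMod 2} {g : L ≃ₐ[ℚ] L},
      g (τ r * τ s * δ) = zmodSign L i * (τ r * τ s * δ) → i = 0 := by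
    intro i g h
    rw [hfix] at h
    exact zmodSign_eq_one_iff.1 (mul_right_cancel₀ hne ((one_mul _).trans h)).symm
  constructor
  · rintro x y ⟨g, hg, hg'⟩
    rw [← sub_eq_zero, ← key (h1 hg hg'), CharTwo.sub_eq_add]
  · obtain ⟨γ, h3, h4⟩ := F.swap
    have := key (h2 (x := 0) (by rw [h3, signInv_zero]) h4)
    rw [map_zero, zero_add] at this
    rw [← sub_eq_zero, ← this, CharTwo.sub_eq_add]

/-- If χ(z) = 0 the product τ(r)τ(s) is fixed by the Galois group, hence rational. If χ(z) = 1 an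
exchange changes its sign, and multiplication by u - v compensates. -/
theorem isSquare_of_blockInvariant [CharZero L] [FiniteDimensional ℚ L] [IsGalois ℚ L]
    (R : OcticRoots a b r s) (F : PreBlockFrame (L ≃ₐ[ℚ] L) signInv r s z)
    {χ : ZMod 2 × ZMod 2 →+ ZMod 2} {τ : L → L} {N M : ℚ} (hτ : OcticForm r s χ τ N M)
    (h : BlockInvariant (L ≃ₐ[ℚ] L) signInv r s χ) :
    IsSquare N ∨ IsSquare (N * (a ^ 2 - 4 * b + 8)) := by
  rcases (χ z).two_eq_zero_or_one with hz | hz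
  · left
    obtain ⟨m, hm⟩ : ∃ m : ℚ, τ r * τ s = m := by
      apply exists_ratCast_eq_of_fixed
      apply F.fixed
      · intro x y hK g h1 h2
        rw [apply_prod hτ.toIsSemiInvariant (.inl ⟨h1, h2⟩), h x y hK, CharTwo.add_self_eq_zero,
          zmodSign_zero, one_mul]
      · intro γ h1 h2
        rw [apply_prod hτ.toIsSemiInvariant (.inr ⟨h1, h2⟩), hz, map_zero, add_zero,
          zmodSign_zero, one_mul]
    refine ⟨m, ?_⟩
    have := hτ.norm
    rw [hm] at this
    exact_mod_cast (this.symm.trans (sq _))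
  · right
    obtain ⟨m, hm⟩ : ∃ m : ℚ, τ r * τ s * (r ^ 2 + (r⁻¹) ^ 2 - (s ^ 2 + (s⁻¹) ^ 2)) = m := by
      apply exists_ratCast_eq_of_fixed
      apply F.fixed
      · intro x y hK g h1 h2
        rw [apply_prod_mul_disc hτ.toIsSemiInvariant h1 h2, h x y hK, CharTwo.add_self_eq_zero,
          zmodSign_zero, one_mul]
      · intro γ h1 h2
        rw [apply_prod_mul_disc_swap hτ.toIsSemiInvariant h1 h2, hz, map_zero, zero_add,
          CharTwo.add_self_eq_zero, zmodSign_zero, one_mul]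
    refine ⟨m, ?_⟩
    have h1 := hτ.norm
    have h2 := R.disc_sq
    have h3 := congrArg (· ^ 2) hm
    simp only [mul_pow _ (r ^ 2 + (r⁻¹) ^ 2 - (s ^ 2 + (s⁻¹) ^ 2)), h1, h2, sq (m : L)] at h3
    exact_mod_cast h3

/-- If the translations `x` of the first block which are induced by elements of `G` lie in the
kernel of a character, then the corresponding quadratic extension is not proper. -/
theorem isSquare_trace_of_forall_smul [CharZero L] [FiniteDimensional ℚ L] [IsGalois ℚ L]
    (F : PreBlockFrame (L ≃ₐ[ℚ] L) signInv r s z)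
    {χ : ZMod 2 × ZMod 2 →+ ZMod 2} {τ : L → L} {N M : ℚ} (hτ : OcticForm r s χ τ N M)
    (h : ∀ x y, BlockRel (L ≃ₐ[ℚ] L) signInv r s x y → χ x = 0) :
    ∃ m, m ^ 2 = N ∧ IsSquare (M + 2 * m) := by
  have h' : ∀ x y, BlockRel (L ≃ₐ[ℚ] L) signInv r s x y → χ y = 0 := fun x y hK =>
    h _ _ (F.rel_swap hK)
  have hz : χ z = 0 := h _ _ F.rel_self
  obtain ⟨m, hm⟩ : ∃ m : ℚ, τ r * τ s = m := by
    apply exists_ratCast_eq_of_fixed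
    apply F.fixed
    · intro x y hK g h1 h2
      rw [apply_prod hτ.toIsSemiInvariant (.inl ⟨h1, h2⟩), h x y hK, h' x y hK, add_zero,
        zmodSign_zero, one_mul]
    · intro γ h1 h2
      rw [apply_prod hτ.toIsSemiInvariant (.inr ⟨h1, h2⟩), hz, map_zero, add_zero,
        zmodSign_zero, one_mul]
  -- The sum is also fixed, and its square is M + 2m.
  obtain ⟨n, hn⟩ : ∃ n : ℚ, τ r + τ s = n := by
    apply exists_ratCast_eq_of_fixed
    apply F.fixed
    · intro x y hK g h1 h2
      rw [map_add, hτ.apply_of_smul h1, hτ.apply_of_smul h2, h x y hK, h' x y hK,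
        zmodSign_zero, one_mul, one_mul]
    · intro γ h1 h2
      rw [map_add, hτ.apply_of_smul h1, hτ.apply_of_smul h2, hz, map_zero,
        zmodSign_zero, one_mul, one_mul, add_comm]
  refine ⟨m, ?_, n, ?_⟩
  · have := hτ.norm
    rw [hm] at this
    exact_mod_cast this
  · have h1 := hτ.trace
    have : ((M + 2 * m : ℚ) : L) = (n * n : ℚ) := by
      push_cast
      rw [← hn, ← hm, ← h1]
      ring
    exact_mod_cast this

end PreBlockFrame

end Galois

/-! ### Separating 8T4 from 8T9. -/

/-- If the pairs of translations form the graph of an involution which is not the identity, then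
the involution interchanges the two characters other than the invariant one. -/
theorem BlockFrame.hom_eq_hom_of_graph {Y G : Type*} [Group G] [MulAction G Y]
    {act : ZMod 2 × ZMod 2 → Y → Y} {p q : Y} {z : ZMod 2 × ZMod 2}
    (F : BlockFrame G act p q z) {χ χ₁ χ₂ : ZMod 2 × ZMod 2 →+ ZMod 2} (h₁ : χ₁ ≠ 0)
    (h₂ : χ₂ ≠ 0) (h₁₂ : χ₁ ≠ χ₂) (hχ : χ = χ₁ + χ₂) (h : BlockInvariant G act p q χ)
    (hd : ¬ BlockInvariant G act p q χ₁) (hc' : ∀ c, BlockRel G act p q 0 c → c = 0)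
    {x y : ZMod 2 × ZMod 2} (hxy : BlockRel G act p q x y) : χ₁ x = χ₂ y := by
  have h2 := ZMod.two_prod_add_self
  have uniq : ∀ {x y y'}, BlockRel G act p q x y → BlockRel G act p q x y' → y = y' := by
    intro x y y' hy hy'
    have := F.rel_add hy hy'
    rw [h2] at this
    rw [← add_zero y, ← h2 y', ← add_assoc, hc' _ this, zero_add]
  have hχ0 : χ ≠ 0 := by
    rintro rfl
    apply h₁₂
    refine AddMonoidHom.ext fun x => ?_
    have := DFunLike.congr_fun hχ x
    simp only [AddMonoidHom.zero_apply, AddMonoidHom.add_apply] at this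
    rw [← sub_eq_zero, this, CharTwo.sub_eq_add]
  obtain ⟨c, hc, hker⟩ := ZMod.two_prod_exists_ker hχ0
  have hχc : χ c = 0 := (hker c).2 (.inr rfl)
  have hone : ∀ i : ZMod 2, i ≠ 0 → i = 1 := by decide
  have h12c : χ₁ c = χ₂ c := by
    rw [hχ, AddMonoidHom.add_apply] at hχc
    rw [← sub_eq_zero, ← hχc, CharTwo.sub_eq_add]
  -- If χ₁(c) = 0, both χ₁ and χ₂ would have kernel {0, c} and would coincide.
  have h1c : χ₁ c = 1 := by
    refine hone _ fun h0 => h₁₂ ?_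
    obtain ⟨c₁, -, hker₁⟩ := ZMod.two_prod_exists_ker h₁
    obtain ⟨c₂, -, hker₂⟩ := ZMod.two_prod_exists_ker h₂
    have e1 : c = c₁ := by simpa [hc] using (hker₁ c).1 h0
    have e2 : c = c₂ := by simpa [hc] using (hker₂ c).1 (h12c ▸ h0)
    subst e1 e2
    refine AddMonoidHom.ext fun x => ?_
    have h0 := (hker₁ x).trans (hker₂ x).symm
    rcases (χ₁ x).two_eq_zero_or_one with h3 | h3
    · rw [h3, h0.1 h3]
    · rw [h3, hone (χ₂ x) fun h4 => by simp [h0.2 h4] at h3]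
  have hχ12 : ∀ x, χ₂ x = χ₁ x + χ x := by
    intro x
    rw [hχ, AddMonoidHom.add_apply, ← add_assoc, CharTwo.add_self_eq_zero, zero_add]
  have hoff : ∀ {x y}, BlockRel G act p q x y → y = x ∨ y = x + c := by
    intro x y hxy
    have : χ (y - x) = 0 := by rw [map_sub, h _ _ hxy, sub_self]
    rcases (hker _).1 this with h | h
    · exact .inl (sub_eq_zero.1 h)
    · exact .inr (by rw [← h]; abel)
  have h0c : ¬ BlockRel G act p q 0 c := fun h => hc (hc' _ h)
  have hc0 : ¬ BlockRel G act p q c 0 := fun h => h0c (F.rel_swap h)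
  obtain ⟨d, hd⟩ : ∃ d, BlockRel G act p q d (d + c) := by
    unfold BlockInvariant at hd
    push Not at hd
    obtain ⟨x, y, hxy, hne⟩ := hd
    rcases hoff hxy with rfl | rfl
    · exact absurd rfl hne
    · exact ⟨x, hxy⟩
  have hd1 : χ d = 1 := by
    refine hone _ fun h0 => ?_
    rcases (hker d).1 h0 with rfl | rfl
    · exact h0c (by simpa using hd)
    · exact hc0 (by simpa [h2] using hd)
  -- The involution is the identity on ker χ and x ↦ x + c outside it; since χ₁(c) = 1 and χ₂ = χ₁ +
  -- χ, it exchanges χ₁ and χ₂.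
  rcases (χ x).two_eq_zero_or_one with hx | hx
  · rcases (hker x).1 hx with rfl | rfl
    · rw [hc' _ hxy, map_zero, map_zero]
    · rcases hoff hxy with rfl | rfl
      · exact h12c
      · exact absurd (by simpa [h2] using hxy) hc0
  · have hxy' : BlockRel G act p q x (x + c) := by
      have : χ (x - d) = 0 := by rw [map_sub, hx, hd1, sub_self]
      rcases (hker _).1 this with h | h
      · rwa [sub_eq_zero.1 h]
      · have hx : x = d + c := by rw [← h]; abel
        rw [hx, add_assoc, h2, add_zero]
        exact F.rel_swap hd
    rw [uniq hxy hxy', hχ12, map_add, map_add, h1c, hχc, hx, add_zero, add_assoc,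
      CharTwo.add_self_eq_zero, add_zero]

variable {L : Type*} [Field L] [Algebra ℚ L] [CharZero L]
  {r s : L} {z : ZMod 2 × ZMod 2}

/-- If K interchanges the two characters, the mixed product τ₁(r)τ₂(s) is fixed by the elements
preserving the blocks, while γ sends it to ε τ₁(s)τ₂(r), with ε the sign of χ₂(z). So the sum and
the product of these two elements are rational, and the square of the sum is T + 2m. -/
theorem isSquare_of_graph [FiniteDimensional ℚ L] [IsGalois ℚ L]
    (F : BlockFrame (L ≃ₐ[ℚ] L) signInv r s z)
    {χ₁ χ₂ : ZMod 2 × ZMod 2 →+ ZMod 2} {τ₁ τ₂ : L → L} {N₁ M₁ N₂ M₂ T : ℚ}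
    (hτ₁ : OcticForm r s χ₁ τ₁ N₁ M₁) (hτ₂ : OcticForm r s χ₂ τ₂ N₂ M₂)
    (hT : (τ₁ r * τ₂ s) ^ 2 + (τ₁ s * τ₂ r) ^ 2 = T)
    (h : ∀ x y, BlockRel (L ≃ₐ[ℚ] L) signInv r s x y → χ₁ x = χ₂ y) :
    ∃ m, m ^ 2 = N₁ * N₂ ∧ IsSquare (T + 2 * m) := by
  have h' : ∀ x y, BlockRel (L ≃ₐ[ℚ] L) signInv r s x y → χ₁ y = χ₂ x := fun x y hK =>
    h _ _ (F.rel_swap hK)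
  have hz : χ₁ z = χ₂ z := h _ _ F.rel_self
  have hs := zmodSign_mul_self (L := L) (χ₂ z)
  obtain ⟨m, hm⟩ : ∃ m : ℚ, zmodSign L (χ₂ z) * (τ₁ r * τ₂ s * (τ₁ s * τ₂ r)) = m := by
    apply exists_ratCast_eq_of_fixed
    apply F.fixed
    · intro x y hK g h1 h2
      simp only [map_mul, map_zmodSign, hτ₁.apply_of_smul h1, hτ₁.apply_of_smul h2,
        hτ₂.apply_of_smul h1, hτ₂.apply_of_smul h2, h x y hK, h' x y hK]
      linear_combination (zmodSign L (χ₂ z) * (τ₁ r * τ₂ s * (τ₁ s * τ₂ r))) *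
        (zmodSign_mul_self (L := L) (χ₂ y) * (zmodSign L (χ₂ x) * zmodSign L (χ₂ x)) +
        zmodSign_mul_self (L := L) (χ₂ x))
    · intro γ h1 h2
      simp only [map_mul, map_zmodSign, hτ₁.apply_of_smul h1, hτ₁.apply_of_smul h2,
        hτ₂.apply_of_smul h1, hτ₂.apply_of_smul h2, hz, map_zero, zmodSign_zero]
      linear_combination (zmodSign L (χ₂ z) * (τ₁ r * τ₂ s * (τ₁ s * τ₂ r))) * hs
  obtain ⟨n, hn⟩ : ∃ n : ℚ, τ₁ r * τ₂ s + zmodSign L (χ₂ z) * (τ₁ s * τ₂ r) = n := by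
    apply exists_ratCast_eq_of_fixed
    apply F.fixed
    · intro x y hK g h1 h2
      simp only [map_add, map_mul, map_zmodSign, hτ₁.apply_of_smul h1, hτ₁.apply_of_smul h2,
        hτ₂.apply_of_smul h1, hτ₂.apply_of_smul h2, h x y hK, h' x y hK]
      linear_combination (τ₁ r * τ₂ s) * zmodSign_mul_self (L := L) (χ₂ y) +
        zmodSign L (χ₂ z) * (τ₁ s * τ₂ r) * zmodSign_mul_self (L := L) (χ₂ x)
    · intro γ h1 h2
      simp only [map_add, map_mul, map_zmodSign, hτ₁.apply_of_smul h1, hτ₁.apply_of_smul h2,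
        hτ₂.apply_of_smul h1, hτ₂.apply_of_smul h2, hz, map_zero, zmodSign_zero]
      linear_combination (τ₁ r * τ₂ s) * hs
  refine ⟨m, ?_, n, ?_⟩
  · have h1 := hτ₁.norm
    have h2 := hτ₂.norm
    have : ((m ^ 2 : ℚ) : L) = (N₁ * N₂ : ℚ) := by
      push_cast
      rw [← hm, ← h1, ← h2]
      linear_combination (τ₁ r * τ₂ s * (τ₁ s * τ₂ r)) ^ 2 * hs
    exact_mod_cast this
  · have : ((T + 2 * m : ℚ) : L) = (n * n : ℚ) := by
      push_cast
      rw [← hn, ← hm, ← hT]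
      linear_combination - (τ₁ s * τ₂ r) ^ 2 * hs
    exact_mod_cast this

/-- Converse test: an element acting by (0, c) multiplies both mixed products by the sign of χ₂(c) =
χ₁(c). A suitable signed sum of them is rational, and nonzero because T + 2m ≠ 0, so this sign is 1.
-/
theorem eq_zero_of_isSquare {χ₁ χ₂ : ZMod 2 × ZMod 2 →+ ZMod 2} {τ₁ τ₂ : L → L}
    {N₁ M₁ N₂ M₂ T m : ℚ}
    (hτ₁ : OcticForm r s χ₁ τ₁ N₁ M₁) (hτ₂ : OcticForm r s χ₂ τ₂ N₂ M₂)
    (hT : (τ₁ r * τ₂ s) ^ 2 + (τ₁ s * τ₂ r) ^ 2 = T)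
    (h : BlockInvariant (L ≃ₐ[ℚ] L) signInv r s (χ₁ + χ₂))
    (hm : m ^ 2 = N₁ * N₂) (hsq : IsSquare (T + 2 * m)) (hne : T + 2 * m ≠ 0)
    {c : ZMod 2 × ZMod 2} (hc : BlockRel (L ≃ₐ[ℚ] L) signInv r s 0 c) : χ₁ c = 0 ∧ χ₂ c = 0 := by
  obtain ⟨n, hn⟩ := hsq
  have h12 : χ₁ c = χ₂ c := by
    have := h _ _ hc
    rw [map_zero, AddMonoidHom.add_apply] at this
    rw [← sub_eq_zero, this, CharTwo.sub_eq_add]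
  obtain ⟨ε, hε, hξ⟩ : ∃ ε : L, (ε = 1 ∨ ε = -1) ∧
      (τ₁ r * τ₂ s) * (τ₁ s * τ₂ r) = ε * m := by
    have : ((τ₁ r * τ₂ s) * (τ₁ s * τ₂ r)) ^ 2 = (m : L) ^ 2 := by
      have h1 := hτ₁.norm
      have h2 := hτ₂.norm
      have h3 : (m : L) ^ 2 = N₁ * N₂ := by exact_mod_cast hm
      rw [h3, ← h1, ← h2]
      ring
    rcases sq_eq_sq_iff_eq_or_eq_neg.1 this with h | h
    · exact ⟨1, .inl rfl, by rw [h, one_mul]⟩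
    · exact ⟨-1, .inr rfl, by rw [h, neg_one_mul]⟩
  have hε2 : ε ^ 2 = 1 := by rcases hε with rfl | rfl <;> norm_num
  have hsum : τ₁ r * τ₂ s + ε * (τ₁ s * τ₂ r) = n ∨ τ₁ r * τ₂ s + ε * (τ₁ s * τ₂ r) = -n := by
    apply sq_eq_sq_iff_eq_or_eq_neg.1
    have : ((n * n : ℚ) : L) = T + 2 * m := by rw [← hn]; push_cast; ring
    push_cast at this
    rw [sq (n : L), this, ← hT]
    linear_combination ((τ₁ s * τ₂ r) ^ 2 + 2 * m) * hε2 + 2 * ε * hξ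
  have hfix : ∀ g : L ≃ₐ[ℚ] L, g (τ₁ r * τ₂ s + ε * (τ₁ s * τ₂ r)) =
      τ₁ r * τ₂ s + ε * (τ₁ s * τ₂ r) := by
    intro g
    rcases hsum with h | h <;> rw [h] <;> simp
  have hne' : τ₁ r * τ₂ s + ε * (τ₁ s * τ₂ r) ≠ 0 := by
    intro h
    apply hne
    rw [h] at hsum
    have : (n : L) = 0 := by
      rcases hsum with h | h
      · exact h.symm
      · exact (neg_eq_zero.1 h.symm)
    rw [hn, Rat.cast_eq_zero.1 this, zero_mul]
  obtain ⟨g, h1, h2⟩ := hc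
  have hgε : g ε = ε := by rcases hε with rfl | rfl <;> simp
  have := hfix g
  simp only [map_add, map_mul, hgε, hτ₁.apply_of_smul h1, hτ₁.apply_of_smul h2,
    hτ₂.apply_of_smul h1, hτ₂.apply_of_smul h2, map_zero, zmodSign_zero, h12] at this
  have h3 : zmodSign L (χ₂ c) * (τ₁ r * τ₂ s + ε * (τ₁ s * τ₂ r)) =
      1 * (τ₁ r * τ₂ s + ε * (τ₁ s * τ₂ r)) := by
    linear_combination this
  have h4 := zmodSign_eq_one_iff.1 (mul_right_cancel₀ hne' h3)
  exact ⟨h12.trans h4, h4⟩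

/-! ### The octic polynomial: separability and existence of representatives. -/

theorem palindromicEvenOctic_natDegree (a b : ℚ) : (palindromicEvenOctic a b).natDegree = 8 := by
  unfold palindromicEvenOctic
  compute_degree!

theorem palindromicEvenOctic_monic (a b : ℚ) : (palindromicEvenOctic a b).Monic := by
  unfold palindromicEvenOctic
  monicity!

theorem not_irreducible_mul {p q : ℚ[X]} (hp : 0 < p.natDegree) (hq : 0 < q.natDegree) :
    ¬ Irreducible (p * q) := by
  intro h
  rcases h.isUnit_or_isUnit rfl with h | h
  · exact hp.ne' (natDegree_eq_zero_of_isUnit h)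
  · exact hq.ne' (natDegree_eq_zero_of_isUnit h)

/-- If D = 0 the octic is a square; if P = 0 it is divisible by (x² + 1)², and if Q = 0 by (x² -
1)². -/
theorem ne_zero_of_irreducible {a b : ℚ} (h : Irreducible (palindromicEvenOctic a b)) :
    a ^ 2 - 4 * b + 8 ≠ 0 ∧ b + 2 - 2 * a ≠ 0 ∧ b + 2 + 2 * a ≠ 0 := by
  refine ⟨fun h0 => ?_, fun h0 => ?_, fun h0 => ?_⟩
  · have hb : b = a ^ 2 / 4 + 2 := by linarith
    have : palindromicEvenOctic a b =
        (X ^ 4 + C (a / 2) * X ^ 2 + 1) * (X ^ 4 + C (a / 2) * X ^ 2 + 1) := by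
      have e1 : C a = 2 * C (a / 2) := by rw [← C_ofNat, ← C_mul]; congr 1; ring
      have e2 : C b = C (a / 2) ^ 2 + 2 := by
        rw [hb, ← C_pow, ← C_ofNat, ← C_add]; congr 1; ring
      rw [palindromicEvenOctic, e1, e2]
      ring
    rw [this] at h
    refine not_irreducible_mul ?_ ?_ h <;>
    · rw [show (X ^ 4 + C (a / 2) * X ^ 2 + 1 : ℚ[X]).natDegree = 4 by compute_degree!]
      norm_num
  · have : palindromicEvenOctic a b =
        (X ^ 4 + 2 * X ^ 2 + 1) * (X ^ 4 + C (a - 2) * X ^ 2 + 1) := by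
      have e2 : C b = 2 * C a - 2 := by
        rw [← C_ofNat, ← C_mul, ← C_sub]; congr 1; linarith
      rw [palindromicEvenOctic, e2, C_sub, C_ofNat]
      ring
    rw [this] at h
    refine not_irreducible_mul ?_ ?_ h
    · rw [show (X ^ 4 + 2 * X ^ 2 + 1 : ℚ[X]).natDegree = 4 by compute_degree!]
      norm_num
    · rw [show (X ^ 4 + C (a - 2) * X ^ 2 + 1 : ℚ[X]).natDegree = 4 by compute_degree!]
      norm_num
  · have : palindromicEvenOctic a b =
        (X ^ 4 - 2 * X ^ 2 + 1) * (X ^ 4 + C (a + 2) * X ^ 2 + 1) := by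
      have e2 : C b = -2 * C a - 2 := by
        rw [← C_ofNat, ← C_neg, ← C_mul, ← C_sub]; congr 1; linarith
      rw [palindromicEvenOctic, e2, C_add, C_ofNat]
      ring
    rw [this] at h
    refine not_irreducible_mul ?_ ?_ h
    · rw [show (X ^ 4 - 2 * X ^ 2 + 1 : ℚ[X]).natDegree = 4 by compute_degree!]
      norm_num
    · rw [show (X ^ 4 + C (a + 2) * X ^ 2 + 1 : ℚ[X]).natDegree = 4 by compute_degree!]
      norm_num

section

variable {L : Type*} [Field L] [Algebra ℚ L] [CharZero L] {a b : ℚ}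

omit [CharZero L] in
theorem aeval_palindromicEvenOctic (x : L) :
    aeval x (palindromicEvenOctic a b) = x ^ 8 + a * x ^ 6 + b * x ^ 4 + a * x ^ 2 + 1 := by
  simp [palindromicEvenOctic]

theorem aeval_palindromicEvenOctic_eq_zero_iff {x : L} :
    aeval x (palindromicEvenOctic a b) = 0 ↔ x ≠ 0 ∧
      (x ^ 2 + (x⁻¹) ^ 2) ^ 2 + a * (x ^ 2 + (x⁻¹) ^ 2) + (b - 2) = 0 := by
  rw [aeval_palindromicEvenOctic]
  by_cases hx : x = 0
  · simp [hx]
  · have h1 := mul_inv_cancel₀ hx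
    have key : x ^ 8 + a * x ^ 6 + b * x ^ 4 + a * x ^ 2 + 1 =
        x ^ 4 * ((x ^ 2 + (x⁻¹) ^ 2) ^ 2 + a * (x ^ 2 + (x⁻¹) ^ 2) + (b - 2)) := by
      field_simp
      ring
    rw [key]
    simp [hx]

theorem OcticRoots.aeval_eq_zero_iff {r s : L} (R : OcticRoots a b r s) {x : L} :
    aeval x (palindromicEvenOctic a b) = 0 ↔ ∃ v, x = signInv v r ∨ x = signInv v s := by
  rw [aeval_palindromicEvenOctic_eq_zero_iff]
  have h1 := R.sum
  have h2 := R.prod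
  constructor
  · rintro ⟨hx, h⟩
    have : (x ^ 2 + (x⁻¹) ^ 2 - (r ^ 2 + (r⁻¹) ^ 2)) *
        (x ^ 2 + (x⁻¹) ^ 2 - (s ^ 2 + (s⁻¹) ^ 2)) = 0 := by
      linear_combination h - (x ^ 2 + (x⁻¹) ^ 2) * h1 + h2
    rcases mul_eq_zero.1 this with h | h
    · exact (exists_signInv_of_sq_add_inv_sq_eq hx R.ne_zero (sub_eq_zero.1 h)).imp
        fun _ => .inl
    · exact (exists_signInv_of_sq_add_inv_sq_eq hx R.ne_zero' (sub_eq_zero.1 h)).imp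
        fun _ => .inr
  · have hne : ∀ v {y : L}, y ≠ 0 → signInv v y ≠ 0 := by
      intro v y hy h
      have := congrArg (signInv v) h
      rw [← signInv_add, ZMod.two_prod_add_self, signInv_zero] at this
      exact hy (this.trans (by simp [signInv]))
    rintro ⟨v, rfl | rfl⟩
    · refine ⟨hne v R.ne_zero, ?_⟩
      rw [sq_add_inv_sq_signInv]
      linear_combination (r ^ 2 + (r⁻¹) ^ 2) * h1 - h2
    · refine ⟨hne v R.ne_zero', ?_⟩
      rw [sq_add_inv_sq_signInv]
      linear_combination (s ^ 2 + (s⁻¹) ^ 2) * h1 - h2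

/-- Existence of representatives of the roots in a field over which the octic splits. -/
theorem exists_octicRoots (hD : a ^ 2 - 4 * b + 8 ≠ 0) (hP : b + 2 - 2 * a ≠ 0)
    (hQ : b + 2 + 2 * a ≠ 0)
    (hs : ((palindromicEvenOctic a b).map (algebraMap ℚ L)).Splits) :
    ∃ r s : L, OcticRoots a b r s := by
  have hpow : ∀ {x : L}, x ≠ 0 →
      (x ^ 2 + (x⁻¹) ^ 2) ^ 2 + a * (x ^ 2 + (x⁻¹) ^ 2) + (b - 2) = 0 → x ^ 4 ≠ 1 := by
    intro x hx h h4
    have : (x ^ 2 - 1) * (x ^ 2 + 1) = 0 := by linear_combination h4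
    rcases mul_eq_zero.1 this with h2 | h2
    · have h2 : x ^ 2 = 1 := sub_eq_zero.1 h2
      rw [inv_pow, h2] at h
      apply hQ
      have : ((b + 2 + 2 * a : ℚ) : L) = 0 := by
        push_cast
        linear_combination h
      exact_mod_cast this
    · have h2 : x ^ 2 = -1 := eq_neg_of_add_eq_zero_left h2
      rw [inv_pow, h2, inv_neg, inv_one] at h
      apply hP
      have : ((b + 2 - 2 * a : ℚ) : L) = 0 := by
        push_cast
        linear_combination h
      exact_mod_cast this
  have hdeg := palindromicEvenOctic_natDegree a b
  obtain ⟨r, hr⟩ := hs.exists_eval_eq_zero (by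
    rw [degree_map]
    intro h
    rw [natDegree_eq_of_degree_eq_some h] at hdeg
    exact absurd hdeg (by norm_num))
  rw [eval_map_algebraMap] at hr
  obtain ⟨hr0, hr⟩ := aeval_palindromicEvenOctic_eq_zero_iff.1 hr
  set u := r ^ 2 + (r⁻¹) ^ 2 with hu
  -- Given u, the other root of the quadratic is -a - u; the two quartic factors collect the roots x
  -- with x² + x⁻² equal to u and to -a - u respectively. A root of the second factor serves as `s`.
  have hdvd : (X ^ 4 + C (a + u) * X ^ 2 + 1 : L[X]) ∣
      (palindromicEvenOctic a b).map (algebraMap ℚ L) := by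
    refine ⟨X ^ 4 - C u * X ^ 2 + 1, ?_⟩
    have hb : (b : L) = 2 - u ^ 2 - a * u := by linear_combination hr
    simp only [palindromicEvenOctic, Polynomial.map_add, Polynomial.map_mul, Polynomial.map_pow,
      map_X, map_C, Polynomial.map_one, eq_ratCast, hb, C_add, C_sub, C_mul, C_pow, C_ofNat]
    ring
  have hs' := hs.of_dvd ((palindromicEvenOctic_monic a b).map _).ne_zero hdvd
  obtain ⟨s, hsr⟩ := hs'.exists_eval_eq_zero (by
    rw [show (X ^ 4 + C (a + u) * X ^ 2 + 1 : L[X]).degree = 4 by compute_degree!]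
    norm_num)
  have hroot : s ^ 4 + (a + u) * s ^ 2 + 1 = 0 := by simpa using hsr
  have hs0 : s ≠ 0 := by
    rintro rfl
    simp at hroot
  have hsum : s ^ 2 + (s⁻¹) ^ 2 = - a - u := by
    field_simp
    linear_combination hroot
  refine ⟨r, s, hr0, hs0, hpow hr0 hr, hpow hs0 ?_, ?_, ?_, ?_⟩
  · rw [hsum]
    linear_combination hr
  · rw [hsum]; ring
  · rw [hsum, ← hu]
    linear_combination -hr
  · rw [hsum, ← hu]
    intro h
    apply hD
    have : ((a ^ 2 - 4 * b + 8 : ℚ) : L) = 0 := by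
      push_cast
      linear_combination (2 * u + a) * h - 4 * hr
    exact_mod_cast this

end

/-! ### Transitivity and irreducibility. -/

/-- A proper subset of `(ℤ/2)²` closed under addition is killed by a nonzero linear form. -/
theorem ZMod.two_prod_exists_hom_eq_zero {U : ZMod 2 × ZMod 2 → Prop}
    (hadd : ∀ x y, U x → U y → U (x + y)) {x₀ : ZMod 2 × ZMod 2} (h₀ : ¬ U x₀) :
    ∃ χ : ZMod 2 × ZMod 2 →+ ZMod 2, χ ≠ 0 ∧ ∀ x, U x → χ x = 0 := by
  by_cases h : ∃ c, c ≠ 0 ∧ U c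
  · obtain ⟨c, hc, hUc⟩ := h
    have hU0 : U 0 := by
      have := hadd c c hUc hUc
      rwa [ZMod.two_prod_add_self] at this
    have hU : ∀ x, U x → x = 0 ∨ x = c := by
      intro x hx
      by_contra! hne
      have : x₀ = 0 ∨ x₀ = c ∨ x₀ = x ∨ x₀ = x + c := by
        have key : ∀ c x x₀ : ZMod 2 × ZMod 2, c ≠ 0 → x ≠ 0 → x ≠ c →
            x₀ = 0 ∨ x₀ = c ∨ x₀ = x ∨ x₀ = x + c := by
          set_option synthInstance.maxSize 1000 in decide
        exact key c x x₀ hc hne.1 hne.2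
      rcases this with rfl | rfl | rfl | rfl
      · exact h₀ hU0
      · exact h₀ hUc
      · exact h₀ hx
      · exact h₀ (hadd _ _ hx hUc)
    have key : ∀ c : ZMod 2 × ZMod 2, c = 0 ∨ c = (1, 0) ∨ c = (0, 1) ∨ c = (1, 1) := by decide
    have : ∃ χ : ZMod 2 × ZMod 2 →+ ZMod 2, χ ≠ 0 ∧ χ c = 0 := by
      rcases key c with rfl | rfl | rfl | rfl
      · exact absurd rfl hc
      · exact ⟨.snd _ _, fun h => by simpa using DFunLike.congr_fun h (0, 1), by simp⟩
      · exact ⟨.fst _ _, fun h => by simpa using DFunLike.congr_fun h (1, 0), by simp⟩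
      · exact ⟨.fst _ _ + .snd _ _,
          fun h => by simpa using DFunLike.congr_fun h (1, 0), by decide⟩
    obtain ⟨χ, hχ, hχc⟩ := this
    refine ⟨χ, hχ, fun x hx => ?_⟩
    rcases hU x hx with rfl | rfl
    · exact map_zero χ
    · exact hχc
  · push Not at h
    refine ⟨.fst _ _, fun h => by simpa using DFunLike.congr_fun h (1, 0), fun x hx => ?_⟩
    by_cases hx0 : x = 0
    · rw [hx0, map_zero]
    · exact absurd hx (h x hx0)

section

variable {L : Type*} [Field L] [Algebra ℚ L] [CharZero L] [FiniteDimensional ℚ L] [IsGalois ℚ L]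
  {a b : ℚ} {r s : L} {z : ZMod 2 × ZMod 2}

/-- If no rational square of the relevant form exists, the Galois group acts transitively on the
roots. -/
theorem PreBlockFrame.blockFrame (F : PreBlockFrame (L ≃ₐ[ℚ] L) signInv r s z)
    (R : OcticRoots a b r s)
    (h₁ : ∀ m : ℚ, m ^ 2 = b + 2 - 2 * a → ¬ IsSquare (4 - a + 2 * m))
    (h₂ : ∀ m : ℚ, m ^ 2 = b + 2 + 2 * a → ¬ IsSquare (-4 - a + 2 * m))
    (h₃ : ∀ m : ℚ, m ^ 2 = (b + 2 - 2 * a) * (b + 2 + 2 * a) →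
      ¬ IsSquare (a ^ 2 - 2 * b - 4 + 2 * m)) :
    BlockFrame (L ≃ₐ[ℚ] L) signInv r s z := by
  refine ⟨F, ?_⟩
  by_contra! hx₀
  obtain ⟨x₀, hx₀⟩ := hx₀
  -- The first coordinates of K are closed under addition and miss x₀, so a nonzero character kills
  -- them; each of the three possible characters is excluded by one hypothesis.
  obtain ⟨χ, hχ, hU⟩ := ZMod.two_prod_exists_hom_eq_zero
    (U := fun x => ∃ y, BlockRel (L ≃ₐ[ℚ] L) signInv r s x y) (x₀ := x₀)
    (by
      rintro x y ⟨x', hx⟩ ⟨y', hy⟩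
      exact ⟨_, F.rel_add hx hy⟩)
    (by
      rintro ⟨y, g, hg, -⟩
      exact hx₀ g hg)
  have hU' : ∀ x y, BlockRel (L ≃ₐ[ℚ] L) signInv r s x y → χ x = 0 := fun x y h => hU x ⟨y, h⟩
  rcases ZMod.two_prod_hom_cases hχ with rfl | rfl | rfl
  · obtain ⟨m, hm, hsq⟩ := F.isSquare_trace_of_forall_smul R.form_add_inv hU'
    exact h₁ m hm hsq
  · obtain ⟨m, hm, hsq⟩ := F.isSquare_trace_of_forall_smul R.form_sub_inv hU'
    exact h₂ m hm hsq
  · obtain ⟨m, hm, hsq⟩ := F.isSquare_trace_of_forall_smul R.form_sq_sub_inv_sq hU'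
    exact h₃ m hm hsq

/-- If no automorphism moved u to v, u would be rational and D = (2u + a)² a square. Replacing `s`
by the image of `r` makes the automorphism send one representative to the other. -/
theorem OcticRoots.exists_preBlockFrame (R : OcticRoots a b r s)
    (hD : ¬ IsSquare (a ^ 2 - 4 * b + 8)) :
    ∃ (t : L) (z : _), OcticRoots a b r t ∧ PreBlockFrame (L ≃ₐ[ℚ] L) signInv r t z := by
  obtain ⟨γ, hγ⟩ : ∃ γ : L ≃ₐ[ℚ] L, γ (r ^ 2 + (r⁻¹) ^ 2) = s ^ 2 + (s⁻¹) ^ 2 := by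
    by_contra! h
    have hfix : ∀ g : L ≃ₐ[ℚ] L, g (r ^ 2 + (r⁻¹) ^ 2) = r ^ 2 + (r⁻¹) ^ 2 := fun g =>
      (R.map_eq_or g).resolve_right (h g)
    obtain ⟨m, hm⟩ := exists_ratCast_eq_of_fixed hfix
    apply hD
    refine ⟨2 * m + a, ?_⟩
    have h1 := R.disc_sq
    have h2 := R.sum
    rw [hm] at h1 h2
    have : ((a ^ 2 - 4 * b + 8 : ℚ) : L) = ((2 * m + a) * (2 * m + a) : ℚ) := by
      rw [← h1]
      push_cast
      have : s ^ 2 + (s⁻¹) ^ 2 = -a - m := by linear_combination h2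
      rw [this]
      ring
    exact_mod_cast this
  have R' : OcticRoots a b r (γ r) :=
    R.of_sq_add_inv_sq_eq (by simpa using R.ne_zero) (by simpa using hγ)
  obtain ⟨z, hz⟩ := R'.preBlockFrame rfl
  exact ⟨_, z, R', hz⟩

-- The eight points of the two blocks are distinct conjugates of `r`.
omit [CharZero L] [FiniteDimensional ℚ L] in
theorem BlockFrame.natDegree_minpoly_le (F : BlockFrame (L ≃ₐ[ℚ] L) signInv r s z) :
    8 ≤ (minpoly ℚ r).natDegree := by
  have hint : IsIntegral ℚ r := Algebra.IsIntegral.isIntegral r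
  have hmem : ∀ g : L ≃ₐ[ℚ] L, g r ∈ (minpoly ℚ r).rootSet L := by
    intro g
    rw [mem_rootSet]
    refine ⟨minpoly.ne_zero hint, ?_⟩
    have := aeval_algHom_apply (g : L →ₐ[ℚ] L) r (minpoly ℚ r)
    simpa using this
  have hlab : ∀ k, BlockFrame.label signInv r s (kleinLabel id Function.injective_id) k ∈
      (minpoly ℚ r).rootSet L := by
    intro k
    unfold BlockFrame.label
    generalize (kleinLabel id Function.injective_id k).1 = v
    obtain ⟨g, hg⟩ := F.surj v
    split_ifs
    · obtain ⟨γ, hγ, -⟩ := F.swap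
      have : (γ * g) r = signInv v s := by
        change (γ * g) • r = _
        rw [mul_smul, hg, F.smul, hγ]
      rw [← this]
      exact hmem _
    · rw [← hg]
      exact hmem g
  have hinj : Function.Injective (fun k => (⟨_, hlab k⟩ : (minpoly ℚ r).rootSet L)) :=
    fun k l h => F.label_injective _ (congrArg Subtype.val h)
  calc 8 = Nat.card (Fin 8) := by simp
    _ ≤ Nat.card ((minpoly ℚ r).rootSet L) := Nat.card_le_card_of_injective _ hinj
    _ = ((minpoly ℚ r).rootSet L).ncard := rfl
    _ ≤ _ := ncard_rootSet_le _ _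

omit [FiniteDimensional ℚ L] in
theorem BlockFrame.irreducible (R : OcticRoots a b r s)
    (F : BlockFrame (L ≃ₐ[ℚ] L) signInv r s z) : Irreducible (palindromicEvenOctic a b) := by
  have hint : IsIntegral ℚ r := Algebra.IsIntegral.isIntegral r
  have hroot : aeval r (palindromicEvenOctic a b) = 0 :=
    R.aeval_eq_zero_iff.2 ⟨0, .inl (signInv_zero r).symm⟩
  have := eq_of_monic_of_dvd_of_natDegree_le (minpoly.monic hint)
    (palindromicEvenOctic_monic a b) (minpoly.dvd _ _ hroot)
    (by rw [palindromicEvenOctic_natDegree]; exact F.natDegree_minpoly_le)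
  rw [this]
  exact minpoly.irreducible hint

-- By irreducibility all eight roots share one minimal polynomial, so the Galois group of the normal
-- extension permutes them transitively.
omit [FiniteDimensional ℚ L] in
theorem OcticRoots.exists_blockFrame (R : OcticRoots a b r s)
    (h : Irreducible (palindromicEvenOctic a b)) :
    ∃ z, BlockFrame (L ≃ₐ[ℚ] L) signInv r s z := by
  have hmin : ∀ {x : L}, (∃ v, x = signInv v r ∨ x = signInv v s) →
      minpoly ℚ x = palindromicEvenOctic a b := fun hx =>
    (minpoly.eq_of_irreducible_of_monic h (R.aeval_eq_zero_iff.2 hx)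
      (palindromicEvenOctic_monic a b)).symm
  have htrans : ∀ {x : L}, (∃ v, x = signInv v r ∨ x = signInv v s) →
      ∃ g : L ≃ₐ[ℚ] L, g r = x := by
    intro x hx
    obtain ⟨g, hg⟩ := (Normal.minpoly_eq_iff_mem_orbit L).1
      ((hmin hx).trans (hmin ⟨0, .inl (signInv_zero r).symm⟩).symm)
    exact ⟨g, hg⟩
  obtain ⟨γ, hγ⟩ := htrans ⟨0, .inr (signInv_zero s).symm⟩
  obtain ⟨z, F⟩ := R.preBlockFrame hγ
  exact ⟨z, F, fun x => htrans ⟨x, .inl rfl⟩⟩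

end

theorem exists_isSplittingField {F : Type} [Field F] [CharZero F] (p : F[X]) :
    ∃ (L : Type) (_ : Field L) (_ : Algebra F L), CharZero L ∧ IsSplittingField F L p :=
  ⟨p.SplittingField, inferInstance, inferInstance,
    charZero_of_injective_algebraMap (algebraMap F p.SplittingField).injective, inferInstance⟩

/-- A criterion for irreducibility of the octic. -/
theorem palindromicEvenOctic_irreducible {a b : ℚ} (hP : b + 2 - 2 * a ≠ 0)
    (hQ : b + 2 + 2 * a ≠ 0) (hD : ¬ IsSquare (a ^ 2 - 4 * b + 8))
    (h₁ : ∀ m : ℚ, m ^ 2 = b + 2 - 2 * a → ¬ IsSquare (4 - a + 2 * m))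
    (h₂ : ∀ m : ℚ, m ^ 2 = b + 2 + 2 * a → ¬ IsSquare (-4 - a + 2 * m))
    (h₃ : ∀ m : ℚ, m ^ 2 = (b + 2 - 2 * a) * (b + 2 + 2 * a) →
      ¬ IsSquare (a ^ 2 - 2 * b - 4 + 2 * m)) : Irreducible (palindromicEvenOctic a b) := by
  have hD0 : a ^ 2 - 4 * b + 8 ≠ 0 := fun h => hD (by rw [h]; exact IsSquare.zero)
  obtain ⟨L, _, _, _, _⟩ := exists_isSplittingField (palindromicEvenOctic a b)
  have := IsSplittingField.finiteDimensional L (palindromicEvenOctic a b)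
  have := Normal.of_isSplittingField (F := ℚ) (E := L) (palindromicEvenOctic a b)
  have : IsGalois ℚ L := { }
  obtain ⟨r, s, R⟩ := exists_octicRoots (L := L) hD0 hP hQ
    (IsSplittingField.splits L (palindromicEvenOctic a b))
  obtain ⟨t, z, R', F⟩ := R.exists_preBlockFrame hD
  exact (F.blockFrame R' h₁ h₂ h₃).irreducible R'

/-! ### Galois groups as permutation groups, read off in a larger field. -/

/-- The permutation group of the roots may be computed in any splitting field. -/
theorem hasGaloisPermGroup_of_isLabelledBy {p : ℚ[X]} (L : Type*) [Field L] [Algebra ℚ L]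
    [IsSplittingField ℚ L p] {n : ℕ} {H : Subgroup (Equiv.Perm (Fin n))} {e : Fin n → L}
    (he : Function.Injective e) (hp : p ≠ 0) (hroot : ∀ k, aeval (e k) p = 0)
    (hn : p.natDegree ≤ n) (h : IsLabelledBy (L ≃ₐ[ℚ] L) H e) : HasGaloisPermGroup p H := by
  let ψ := IsSplittingField.algEquiv L p
  have hmem : ∀ k, ψ (e k) ∈ p.rootSet p.SplittingField := fun k =>
    mem_rootSet.2 ⟨hp, by
      have := aeval_algHom_apply ψ.toAlgHom (e k) p
      rw [hroot, map_zero] at this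
      exact this⟩
  have hinj : Function.Injective (fun k => (⟨ψ (e k), hmem k⟩ : p.rootSet p.SplittingField)) :=
    fun k l h => he (ψ.injective (congrArg Subtype.val h))
  -- There are at most `n` roots by the degree bound, so `n` distinct ones exhaust them.
  have hbij := hinj.bijective_of_nat_card_le (by
    refine (ncard_rootSet_le p _).trans ?_
    rwa [Nat.card_eq_fintype_card, Fintype.card_fin])
  refine ⟨Equiv.ofBijective _ hbij, fun σ => (h σ).trans ?_⟩
  constructor
  · rintro ⟨g, hg⟩
    refine ⟨(ψ.symm.trans g).trans ψ, fun i => ?_⟩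
    change ψ (g (ψ.symm (ψ (e i)))) = ψ (e (σ i))
    rw [ψ.symm_apply_apply, ← hg]
    rfl
  · rintro ⟨φ, hφ⟩
    refine ⟨(ψ.trans φ).trans ψ.symm, fun i => ?_⟩
    change ψ.symm (φ (ψ (e i))) = e (σ i)
    rw [ψ.symm_apply_eq]
    exact hφ i

theorem hasGaloisPermGroup_of_orbitsLabelledBy {L : Type*} [Field L] [Algebra ℚ L] [CharZero L]
    {a b : ℚ} [IsSplittingField ℚ L (palindromicEvenOctic a b)] {r s : L}
    (R : OcticRoots a b r s) {H : Subgroup (Equiv.Perm (Fin 8))}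
    (h : OrbitsLabelledBy (L ≃ₐ[ℚ] L) signInv r s H) :
    HasGaloisPermGroup (palindromicEvenOctic a b) H := by
  obtain ⟨e, he, h1, h2⟩ := h
  exact hasGaloisPermGroup_of_isLabelledBy L he (palindromicEvenOctic_monic a b).ne_zero
    (fun k => R.aeval_eq_zero_iff.2 (h1 k)) (palindromicEvenOctic_natDegree a b).le h2

/-- The Galois group of `p` is isomorphic to a group `M` of permutations, if `M` consists of the
permutations of the roots of `p` in a larger field which are induced by automorphisms. -/
theorem nonempty_gal_mulEquiv {p : ℚ[X]} {L : Type*} [Field L] [Algebra ℚ L] [Normal ℚ L]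
    (hs : (p.map (algebraMap ℚ L)).Splits) {n : ℕ} {e : Fin n → L} (he : Function.Injective e)
    (hp : ∀ x, x ∈ p.rootSet L ↔ ∃ k, x = e k) {M : Type*} [Group M]
    (m : M →* Equiv.Perm (Fin n)) (hm : Function.Injective m)
    (h : ∀ σ : Equiv.Perm (Fin n), (∃ y, m y = σ) ↔ ∃ g : L ≃ₐ[ℚ] L, ∀ k, g • e k = e (σ k)) :
    Nonempty (p.Gal ≃* M) := by
  have : Fact ((p.map (algebraMap ℚ L)).Splits) := ⟨hs⟩
  let E : Fin n ≃ p.rootSet L := Equiv.ofBijective (fun k => ⟨e k, (hp _).2 ⟨k, rfl⟩⟩)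
    ⟨fun k l h => he (congrArg Subtype.val h), fun x => by
      obtain ⟨k, hk⟩ := (hp x).1 x.2
      exact ⟨k, Subtype.ext hk.symm⟩⟩
  let j : p.Gal →* Equiv.Perm (Fin n) :=
    (Equiv.permCongrHom E.symm).toMonoidHom.comp (Gal.galActionHom p L)
  have hj : Function.Injective j :=
    (Equiv.permCongrHom E.symm).injective.comp (Gal.galActionHom_injective p L)
  -- Both groups embed in the same symmetric group; equality of the images gives the isomorphism.
  have hrange : j.range = m.range := by
    ext σ
    rw [MonoidHom.mem_range, MonoidHom.mem_range, h]
    have key : ∀ (g : L ≃ₐ[ℚ] L) k, E (j (Gal.restrict p L g) k) = g • e k := by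
      intro g k
      have : j (Gal.restrict p L g) k =
        E.symm (Gal.galActionHom p L (Gal.restrict p L g) (E k)) := rfl
      rw [this, E.apply_symm_apply, Gal.galActionHom_restrict]
      rfl
    constructor
    · rintro ⟨φ, rfl⟩
      obtain ⟨g, rfl⟩ := Gal.restrict_surjective p L φ
      exact ⟨g, fun k => (key g k).symm⟩
    · rintro ⟨g, hg⟩
      refine ⟨Gal.restrict p L g, ?_⟩
      ext1 k
      exact he ((key g k).trans (hg k))
  exact ⟨(MonoidHom.ofInjective hj).trans ((MulEquiv.subgroupCongr hrange).trans
    (MonoidHom.ofInjective hm).symm)⟩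

/-! ### The quartic and its Galois group. -/

section inversion

variable {L : Type*} [Field L]

/-- The action of `ℤ/2` by inversion. -/
def invAct (i : ZMod 2) (y : L) : L := if i = 0 then y else y⁻¹

theorem invAct_add (i j : ZMod 2) (y : L) : invAct (i + j) y = invAct i (invAct j y) := by
  rcases i.two_eq_zero_or_one with rfl | rfl <;> rcases j.two_eq_zero_or_one with rfl | rfl <;>
    simp [invAct, show (1 : ZMod 2) + 1 = 0 by decide]

theorem signInv_sq (v : ZMod 2 × ZMod 2) (y : L) : signInv v y ^ 2 = invAct v.2 (y ^ 2) := by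
  obtain ⟨i, j⟩ := v
  rcases i.two_eq_zero_or_one with rfl | rfl <;> rcases j.two_eq_zero_or_one with rfl | rfl <;>
    simp [signInv, invAct]

theorem invAct_injective {y : L} (hy : y ≠ 0) (h : y ^ 2 ≠ 1) (i j : ZMod 2)
    (hij : invAct i y = invAct j y) : i = j := by
  rcases i.two_eq_zero_or_one with rfl | rfl <;> rcases j.two_eq_zero_or_one with rfl | rfl <;>
    simp [invAct] at hij ⊢
  all_goals
    field_simp at hij
    first | exact h hij | exact h hij.symm

end inversion

section quartic

variable {L : Type*} [Field L] [Algebra ℚ L] [CharZero L] {a b : ℚ} {r s : L}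
  {z : ZMod 2 × ZMod 2}

-- Squaring kills the sign, so only the second coordinate of V survives as the action of inversion.
omit [CharZero L] in
theorem BlockFrame.quartic (R : OcticRoots a b r s)
    (F : BlockFrame (L ≃ₐ[ℚ] L) signInv r s z) :
    BlockFrame (L ≃ₐ[ℚ] L) invAct (r ^ 2) (s ^ 2) z.2 where
  add := invAct_add
  zero y := by simp [invAct]
  smul g i y := by
    rcases i.two_eq_zero_or_one with rfl | rfl <;> simp [invAct]
  inj := invAct_injective (pow_ne_zero 2 R.ne_zero) fun h => R.pow_four (by
    rw [show r ^ 4 = (r ^ 2) ^ 2 by ring, h])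
  disj i j h := by
    rw [← signInv_sq (0, i), ← signInv_sq (0, j)] at h
    apply R.ne
    rw [← sq_add_inv_sq_signInv (0, i) r, ← sq_add_inv_sq_signInv (0, j) s, inv_pow, inv_pow, h]
  cover g := by
    refine (F.cover g).imp ?_ ?_ <;>
    · rintro ⟨x, hx⟩
      exact ⟨x.2, by rw [← signInv_sq, ← hx, smul_pow']⟩
  swap := by
    obtain ⟨γ, h1, h2⟩ := F.swap
    exact ⟨γ, by rw [smul_pow', h1], by rw [← signInv_sq, ← h2, smul_pow']⟩
  surj i := by
    obtain ⟨g, hg⟩ := F.surj (0, i)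
    exact ⟨g, by rw [smul_pow', hg, signInv_sq]⟩

omit [CharZero L] in
theorem blockRel_quartic_iff (R : OcticRoots a b r s)
    (F : BlockFrame (L ≃ₐ[ℚ] L) signInv r s z) {i j : ZMod 2} :
    BlockRel (L ≃ₐ[ℚ] L) invAct (r ^ 2) (s ^ 2) i j ↔
      ∃ x y, BlockRel (L ≃ₐ[ℚ] L) signInv r s x y ∧ x.2 = i ∧ y.2 = j := by
  have F' := F.quartic R
  constructor
  · rintro ⟨g, h1, h2⟩
    rw [smul_pow'] at h1 h2
    rcases F.cases g with ⟨x, y, h3, h4⟩ | ⟨x, y, h3, h4⟩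
    · rw [h3, signInv_sq] at h1
      rw [h4, signInv_sq] at h2
      exact ⟨x, y, ⟨g, h3, h4⟩, F'.inj _ _ h1, F'.inj_right _ _ h2⟩
    · rw [h3, signInv_sq] at h1
      exact absurd h1.symm (F'.disj _ _)
  · rintro ⟨x, y, ⟨g, h1, h2⟩, rfl, rfl⟩
    exact ⟨g, by rw [smul_pow', h1, signInv_sq], by rw [smul_pow', h2, signInv_sq]⟩

/-- Numbering of the roots of the quartic. -/
def quarticLabel : Fin 4 ≃ ZMod 2 × Bool where
  -- The order r², s², r⁻², s⁻² makes the exchange with z.2 = 1 the 4-cycle (0 1 2 3), and the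
  -- inversion of r² and r⁻² alone the transposition (0 2).
  toFun := ![(0, false), (0, true), (1, false), (1, true)]
  invFun w := if w.1 = 0 then (if w.2 then 1 else 0) else (if w.2 then 3 else 2)
  left_inv := by decide
  right_inv := by decide

omit [CharZero L] in
theorem aeval_palindromicQuartic (R : OcticRoots a b r s) (x : L) :
    aeval x (palindromicQuartic a b) =
      (x - r ^ 2) * (x - (r ^ 2)⁻¹) * ((x - s ^ 2) * (x - (s ^ 2)⁻¹)) := by
  have hr := mul_inv_cancel₀ (pow_ne_zero 2 R.ne_zero)
  have hs := mul_inv_cancel₀ (pow_ne_zero 2 R.ne_zero')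
  have h1 := R.sum
  have h2 := R.prod
  simp only [palindromicQuartic, map_add, map_mul, map_pow, aeval_X, aeval_C, map_one,
    eq_ratCast]
  simp only [inv_pow] at h1 h2
  generalize (r ^ 2)⁻¹ = r' at *
  generalize (s ^ 2)⁻¹ = s' at *
  have e1 : (x - r ^ 2) * (x - r') = x ^ 2 - (r ^ 2 + r') * x + 1 := by
    linear_combination hr
  have e2 : (x - s ^ 2) * (x - s') = x ^ 2 - (s ^ 2 + s') * x + 1 := by
    linear_combination hs
  rw [e1, e2]
  linear_combination (x ^ 3 + x) * h1 - x ^ 2 * h2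

omit [CharZero L] in
theorem palindromicQuartic_mem_rootSet (R : OcticRoots a b r s) {x : L} :
    x ∈ (palindromicQuartic a b).rootSet L ↔ ∃ k, x = BlockFrame.label invAct (r ^ 2) (s ^ 2)
      quarticLabel k := by
  have hne : palindromicQuartic a b ≠ 0 := by
    have : (palindromicQuartic a b).Monic := by
      unfold palindromicQuartic
      monicity!
    exact this.ne_zero
  rw [mem_rootSet, and_iff_right hne, aeval_palindromicQuartic R]
  simp only [mul_eq_zero, sub_eq_zero, Fin.exists_fin_succ, BlockFrame.label, quarticLabel,
    invAct, Equiv.coe_fn_mk]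
  simp
  tauto

theorem palindromicQuartic_splits (R : OcticRoots a b r s) :
    ((palindromicQuartic a b).map (algebraMap ℚ L)).Splits := by
  have : (palindromicQuartic a b).map (algebraMap ℚ L) =
      (X - C (r ^ 2)) * (X - C (r ^ 2)⁻¹) * ((X - C (s ^ 2)) * (X - C (s ^ 2)⁻¹)) := by
    apply Polynomial.funext
    intro x
    rw [eval_map_algebraMap, aeval_palindromicQuartic R]
    simp
  rw [this]
  exact ((Splits.X_sub_C _).mul (Splits.X_sub_C _)).mul
    ((Splits.X_sub_C _).mul (Splits.X_sub_C _))

variable [Normal ℚ L]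

theorem nonempty_gal_palindromicQuartic_mulEquiv (R : OcticRoots a b r s)
    (F : BlockFrame (L ≃ₐ[ℚ] L) signInv r s z) {M : Type*} [Group M]
    (m : M →* Equiv.Perm (Fin 4)) (hm : Function.Injective m)
    (h : ∀ σ : Equiv.Perm (Fin 4), (∃ y, m y = σ) ↔ ∃ i j τ,
      (∃ x y, BlockRel (L ≃ₐ[ℚ] L) signInv r s x y ∧ x.2 = i ∧ y.2 = j - if τ then z.2 else 0) ∧
        ∀ k, quarticLabel (σ k) = wreathAct i j τ (quarticLabel k)) :
    Nonempty ((palindromicQuartic a b).Gal ≃* M) := by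
  have F' := F.quartic R
  refine nonempty_gal_mulEquiv (palindromicQuartic_splits R) (F'.label_injective quarticLabel)
    (fun x => palindromicQuartic_mem_rootSet R) m hm fun σ => (h σ).trans ?_
  rw [F'.smul_label_iff quarticLabel]
  simp only [blockRel_quartic_iff R F]

/-- The regular permutation representation of the elementary abelian group of order `4`. -/
def permE4 : Multiplicative (ZMod 2 × ZMod 2) →* Equiv.Perm (Fin 4) :=
  MonoidHom.mk' (fun v => (c[0, 1] * c[2, 3] : Equiv.Perm (Fin 4)) ^ v.toAdd.1.val *
    (c[0, 2] * c[1, 3] : Equiv.Perm (Fin 4)) ^ v.toAdd.2.val) (by decide)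

/-- The regular permutation representation of the cyclic group of order `4`. -/
def permC4 : Multiplicative (ZMod 4) →* Equiv.Perm (Fin 4) :=
  MonoidHom.mk' (fun v => (c[0, 1, 2, 3] : Equiv.Perm (Fin 4)) ^ v.toAdd.val) (by decide)

/-- The permutation representation of the dihedral group on the vertices of a square. -/
def permD4 : DihedralGroup 4 →* Equiv.Perm (Fin 4) :=
  MonoidHom.mk' (fun
    | .r i => (c[0, 1, 2, 3] : Equiv.Perm (Fin 4)) ^ i.val
    | .sr i => (c[0, 2] : Equiv.Perm (Fin 4)) * (c[0, 1, 2, 3] : Equiv.Perm (Fin 4)) ^ i.val)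
    (by decide)

theorem isE4_palindromicQuartic (R : OcticRoots a b r s)
    (F : BlockFrame (L ≃ₐ[ℚ] L) signInv r s z)
    (h : BlockInvariant (L ≃ₐ[ℚ] L) signInv r s (.snd _ _)) (hz : z.2 = 0) :
    IsE4 (palindromicQuartic a b).Gal := by
  refine nonempty_gal_palindromicQuartic_mulEquiv R F permE4 (by decide) ?_
  have : ∀ i j, (∃ x y, BlockRel (L ≃ₐ[ℚ] L) signInv r s x y ∧ x.2 = i ∧ y.2 = j) ↔ i = j := by
    intro i j
    constructor
    · rintro ⟨x, y, hxy, rfl, rfl⟩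
      exact h _ _ hxy
    · rintro rfl
      obtain ⟨y, hy⟩ := F.rel_surj (0, i)
      exact ⟨_, y, hy, rfl, (h _ _ hy).symm⟩
  simp only [this, hz]
  decide

theorem isC4_palindromicQuartic (R : OcticRoots a b r s)
    (F : BlockFrame (L ≃ₐ[ℚ] L) signInv r s z)
    (h : BlockInvariant (L ≃ₐ[ℚ] L) signInv r s (.snd _ _)) (hz : z.2 = 1) :
    IsC4 (palindromicQuartic a b).Gal := by
  refine nonempty_gal_palindromicQuartic_mulEquiv R F permC4 (by decide) ?_
  have : ∀ i j, (∃ x y, BlockRel (L ≃ₐ[ℚ] L) signInv r s x y ∧ x.2 = i ∧ y.2 = j) ↔ i = j := by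
    intro i j
    constructor
    · rintro ⟨x, y, hxy, rfl, rfl⟩
      exact h _ _ hxy
    · rintro rfl
      obtain ⟨y, hy⟩ := F.rel_surj (0, i)
      exact ⟨_, y, hy, rfl, (h _ _ hy).symm⟩
  simp only [this, hz]
  decide

theorem isD4_palindromicQuartic (R : OcticRoots a b r s)
    (F : BlockFrame (L ≃ₐ[ℚ] L) signInv r s z)
    (h : ¬ BlockInvariant (L ≃ₐ[ℚ] L) signInv r s (.snd _ _)) :
    IsD4 (palindromicQuartic a b).Gal := by
  refine nonempty_gal_palindromicQuartic_mulEquiv R F permD4 (by decide) ?_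
  have key : ∀ i j : ZMod 2, i ≠ j → i = 0 ∧ j = 1 ∨ i = 1 ∧ j = 0 := by decide
  obtain ⟨x₀, y₀, hxy, hx, hy⟩ : ∃ x y, BlockRel (L ≃ₐ[ℚ] L) signInv r s x y ∧
      x.2 = 0 ∧ y.2 = 1 := by
    unfold BlockInvariant at h
    push Not at h
    obtain ⟨x, y, hxy, hne⟩ := h
    rcases key _ _ hne with ⟨h1, h2⟩ | ⟨h1, h2⟩
    · exact ⟨x, y, hxy, h1, h2⟩
    · exact ⟨y, x, F.rel_swap hxy, h2, h1⟩
  -- Adding a pair with second coordinates (0, 1) changes `j` and leaves `i` alone, so all pairs of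
  -- inversions occur.
  have : ∀ i j, (∃ x y, BlockRel (L ≃ₐ[ℚ] L) signInv r s x y ∧ x.2 = i ∧ y.2 = j) := by
    intro i j
    obtain ⟨y, hy'⟩ := F.rel_surj (0, i)
    by_cases h : y.2 = j
    · exact ⟨_, y, hy', rfl, h⟩
    · refine ⟨_, _, F.rel_add hy' hxy, by simp [hx], ?_⟩
      rw [Prod.snd_add, hy]
      exact (show ∀ i j : ZMod 2, i ≠ j → i + 1 = j by decide) _ _ h
  simp only [this, true_and]
  decide

end quartic

theorem not_isE4_and_isC4 {G : Type*} [Group G] (h₁ : IsE4 G) (h₂ : IsC4 G) : False := by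
  obtain ⟨e⟩ := h₁
  obtain ⟨f⟩ := h₂
  have h : ∀ x : Multiplicative (ZMod 4), x * x = 1 := by
    intro x
    apply (f.symm.trans e).injective
    rw [map_mul, map_one]
    exact (show ∀ x : Multiplicative (ZMod 2 × ZMod 2), x * x = 1 by decide) _
  revert h
  decide

theorem not_isE4_and_isD4 {G : Type*} [Group G] (h₁ : IsE4 G) (h₂ : IsD4 G) : False := by
  obtain ⟨e⟩ := h₁
  obtain ⟨f⟩ := h₂
  have := Fintype.card_congr (e.symm.trans f).toEquiv
  revert this
  decide

theorem not_isC4_and_isD4 {G : Type*} [Group G] (h₁ : IsC4 G) (h₂ : IsD4 G) : False := by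
  obtain ⟨e⟩ := h₁
  obtain ⟨f⟩ := h₂
  have := Fintype.card_congr (e.symm.trans f).toEquiv
  revert this
  decide

/-! ### The case distinction. -/

theorem exists_splitting_blockFrame {a b : ℚ} (h : Irreducible (palindromicEvenOctic a b)) :
    ∃ (L : Type) (_ : Field L) (_ : Algebra ℚ L) (_ : CharZero L) (r s : L) (z : ZMod 2 × ZMod 2),
      IsSplittingField ℚ L (palindromicEvenOctic a b) ∧ FiniteDimensional ℚ L ∧ IsGalois ℚ L ∧
      OcticRoots a b r s ∧ BlockFrame (L ≃ₐ[ℚ] L) signInv r s z := by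
  obtain ⟨L, _, _, _, hL⟩ := exists_isSplittingField (palindromicEvenOctic a b)
  have hfin := IsSplittingField.finiteDimensional L (palindromicEvenOctic a b)
  have := Normal.of_isSplittingField (F := ℚ) (E := L) (palindromicEvenOctic a b)
  have hgal : IsGalois ℚ L := { }
  obtain ⟨hD, hP, hQ⟩ := ne_zero_of_irreducible h
  obtain ⟨r, s, R⟩ := exists_octicRoots (L := L) hD hP hQ
    (IsSplittingField.splits L (palindromicEvenOctic a b))
  obtain ⟨z, F⟩ := R.exists_blockFrame h
  exact ⟨L, _, _, ‹_›, r, s, z, hL, hfin, hgal, R, F⟩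

theorem BlockInvariant.eq {Y G : Type*} [Group G] [MulAction G Y]
    {act : ZMod 2 × ZMod 2 → Y → Y} {p q : Y}
    (h : BlockInvariant G act p q (.fst _ _)) (h' : BlockInvariant G act p q (.snd _ _))
    (x y : ZMod 2 × ZMod 2) (hxy : BlockRel G act p q x y) : y = x :=
  Prod.ext (h x y hxy).symm (h' x y hxy).symm

theorem BlockInvariant.sub {Y G : Type*} [Group G] [MulAction G Y]
    {act : ZMod 2 × ZMod 2 → Y → Y} {p q : Y} {χ χ' : ZMod 2 × ZMod 2 →+ ZMod 2}
    (h : BlockInvariant G act p q χ) (h' : BlockInvariant G act p q (χ + χ')) :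
    BlockInvariant G act p q χ' := fun x y hxy => by
  have := h' x y hxy
  rwa [AddMonoidHom.add_apply, AddMonoidHom.add_apply, h x y hxy, add_right_inj] at this

theorem AddMonoidHom.fst_ne_zero_two : (.fst (ZMod 2) (ZMod 2) : ZMod 2 × ZMod 2 →+ ZMod 2) ≠ 0 :=
  fun h => by simpa using DFunLike.congr_fun h (1, 0)

theorem AddMonoidHom.snd_ne_zero_two : (.snd (ZMod 2) (ZMod 2) : ZMod 2 × ZMod 2 →+ ZMod 2) ≠ 0 :=
  fun h => by simpa using DFunLike.congr_fun h (0, 1)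

theorem AddMonoidHom.fst_add_snd_ne_zero_two :
    (.fst (ZMod 2) (ZMod 2) + .snd (ZMod 2) (ZMod 2) : ZMod 2 × ZMod 2 →+ ZMod 2) ≠ 0 :=
  fun h => by simpa using DFunLike.congr_fun h (1, 0)

/-- The Galois groups of the octic, according to that of the quartic. -/
theorem hasGaloisPermGroup_cases {a b : ℚ} (h : Irreducible (palindromicEvenOctic a b)) :
    (IsE4 (palindromicQuartic a b).Gal →
      HasGaloisPermGroup (palindromicEvenOctic a b) group8T2 ∨
      HasGaloisPermGroup (palindromicEvenOctic a b) group8T3 ∨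
      HasGaloisPermGroup (palindromicEvenOctic a b) group8T4 ∨
      HasGaloisPermGroup (palindromicEvenOctic a b) group8T9) ∧
    (IsC4 (palindromicQuartic a b).Gal →
      HasGaloisPermGroup (palindromicEvenOctic a b) group8T2 ∨
      HasGaloisPermGroup (palindromicEvenOctic a b) group8T10) ∧
    (IsD4 (palindromicQuartic a b).Gal →
      HasGaloisPermGroup (palindromicEvenOctic a b) group8T4 ∨
      HasGaloisPermGroup (palindromicEvenOctic a b) group8T9 ∨
      HasGaloisPermGroup (palindromicEvenOctic a b) group8T10 ∨
      HasGaloisPermGroup (palindromicEvenOctic a b) group8T18) := by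
  obtain ⟨L, _, _, _, r, s, z, _, _, _, R, F⟩ := exists_splitting_blockFrame h
  have not_diag : ∀ {χ : ZMod 2 × ZMod 2 →+ ZMod 2},
      ¬ BlockInvariant (L ≃ₐ[ℚ] L) signInv r s χ →
      ¬ ∀ x y, BlockRel (L ≃ₐ[ℚ] L) signInv r s x y → y = x := fun hχ h =>
    hχ fun x y hxy => by rw [h x y hxy]
  -- With an invariant χ, χ(z) = 0 and K off the diagonal, only the presence of a pair (0, c) with c
  -- ≠ 0 remains to be decided.
  have graph : ∀ {χ : ZMod 2 × ZMod 2 →+ ZMod 2}, χ ≠ 0 →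
      BlockInvariant (L ≃ₐ[ℚ] L) signInv r s χ → χ z = 0 →
      (¬ ∀ x y, BlockRel (L ≃ₐ[ℚ] L) signInv r s x y → y = x) →
      HasGaloisPermGroup (palindromicEvenOctic a b) group8T4 ∨
      HasGaloisPermGroup (palindromicEvenOctic a b) group8T9 := by
    intro χ hχ hinv hz hd
    by_cases hc : ∀ c, BlockRel (L ≃ₐ[ℚ] L) signInv r s 0 c → c = 0
    · exact .inl (hasGaloisPermGroup_of_orbitsLabelledBy R
        (F.orbitsLabelledBy_group8T4 hχ hinv hd hc))
    · push Not at hc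
      obtain ⟨c, hc', hc⟩ := hc
      exact .inr (hasGaloisPermGroup_of_orbitsLabelledBy R
        (F.orbitsLabelledBy_group8T9 hχ hinv hz hc hc'))
  by_cases hsnd : BlockInvariant (L ≃ₐ[ℚ] L) signInv r s (.snd _ _)
  · rcases z.2.two_eq_zero_or_one with hz | hz
    · have hE := isE4_palindromicQuartic R F hsnd hz
      refine ⟨fun _ => ?_, fun h => (not_isE4_and_isC4 hE h).elim,
        fun h => (not_isE4_and_isD4 hE h).elim⟩
      by_cases hd : ∀ x y, BlockRel (L ≃ₐ[ℚ] L) signInv r s x y → y = x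
      · by_cases hz : z = 0
        · exact .inr (.inl (hasGaloisPermGroup_of_orbitsLabelledBy R
            (F.orbitsLabelledBy_group8T3 hd hz)))
        · exact .inl (hasGaloisPermGroup_of_orbitsLabelledBy R
            (F.orbitsLabelledBy_group8T2 hd hz))
      · exact .inr (.inr (graph AddMonoidHom.snd_ne_zero_two hsnd hz hd))
    · have hC := isC4_palindromicQuartic R F hsnd hz
      refine ⟨fun h => (not_isE4_and_isC4 h hC).elim, fun _ => ?_,
        fun h => (not_isC4_and_isD4 hC h).elim⟩
      by_cases hd : ∀ x y, BlockRel (L ≃ₐ[ℚ] L) signInv r s x y → y = x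
      · refine .inl (hasGaloisPermGroup_of_orbitsLabelledBy R
          (F.orbitsLabelledBy_group8T2 hd ?_))
        rintro rfl
        simp at hz
      · exact .inr (hasGaloisPermGroup_of_orbitsLabelledBy R
          (F.orbitsLabelledBy_group8T10 hsnd (by simp [hz]) hd))
  · have hD := isD4_palindromicQuartic R F hsnd
    refine ⟨fun h => (not_isE4_and_isD4 h hD).elim, fun h => (not_isC4_and_isD4 h hD).elim,
      fun _ => ?_⟩
    have hd := not_diag hsnd
    by_cases hex : ∃ χ : ZMod 2 × ZMod 2 →+ ZMod 2, χ ≠ 0 ∧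
        BlockInvariant (L ≃ₐ[ℚ] L) signInv r s χ
    · obtain ⟨χ, hχ, hinv⟩ := hex
      by_cases hz : χ z = 0
      · exact (graph hχ hinv hz hd).imp id .inl
      · exact .inr (.inr (.inl (hasGaloisPermGroup_of_orbitsLabelledBy R
          (F.orbitsLabelledBy_group8T10 hinv hz hd))))
    · push Not at hex
      exact .inr (.inr (.inr (hasGaloisPermGroup_of_orbitsLabelledBy R
        (F.orbitsLabelledBy_group8T18 hex))))

/-! ### Numerical criteria for each group. -/

theorem isE4_gal_of_isSquare {a b : ℚ}
    (h : Irreducible (palindromicEvenOctic a b))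
    (hsq : IsSquare ((b + 2 - 2 * a) * (b + 2 + 2 * a))) :
    IsE4 (palindromicQuartic a b).Gal := by
  obtain ⟨L, _, _, _, r, s, z, _, _, _, R, F⟩ := exists_splitting_blockFrame h
  obtain ⟨h1, h2⟩ := F.blockInvariant_of_isSquare R.form_sq_sub_inv_sq hsq
  exact isE4_palindromicQuartic R F h1 h2

theorem isC4_gal_of_isSquare {a b : ℚ}
    (h : Irreducible (palindromicEvenOctic a b))
    (hsq : IsSquare (((b + 2 - 2 * a) * (b + 2 + 2 * a)) * (a ^ 2 - 4 * b + 8))) :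
    IsC4 (palindromicQuartic a b).Gal := by
  obtain ⟨L, _, _, _, r, s, z, _, _, _, R, F⟩ := exists_splitting_blockFrame h
  obtain ⟨h1, h2⟩ := F.blockInvariant_of_isSquare_mul R R.form_sq_sub_inv_sq hsq
  exact isC4_palindromicQuartic R F h1 h2

theorem isD4_gal_of_not_isSquare {a b : ℚ}
    (h : Irreducible (palindromicEvenOctic a b))
    (hn1 : ¬ IsSquare ((b + 2 - 2 * a) * (b + 2 + 2 * a)))
    (hn1' : ¬ IsSquare (((b + 2 - 2 * a) * (b + 2 + 2 * a)) * (a ^ 2 - 4 * b + 8))) :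
    IsD4 (palindromicQuartic a b).Gal := by
  obtain ⟨L, _, _, _, r, s, z, _, _, _, R, F⟩ := exists_splitting_blockFrame h
  exact isD4_palindromicQuartic R F fun hi =>
    (F.isSquare_of_blockInvariant R R.form_sq_sub_inv_sq hi).elim hn1 hn1'

theorem hasGaloisPermGroup_group8T3 {a b : ℚ}
    (h : Irreducible (palindromicEvenOctic a b))
    (hP : IsSquare (b + 2 - 2 * a))
    (hQ : IsSquare (b + 2 + 2 * a)) :
    HasGaloisPermGroup (palindromicEvenOctic a b) group8T3 := by
  obtain ⟨L, _, _, _, r, s, z, _, _, _, R, F⟩ := exists_splitting_blockFrame h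
  obtain ⟨h1, h2⟩ := F.blockInvariant_of_isSquare R.form_add_inv hP
  obtain ⟨h3, h4⟩ := F.blockInvariant_of_isSquare R.form_sub_inv hQ
  refine hasGaloisPermGroup_of_orbitsLabelledBy R
    (F.orbitsLabelledBy_group8T3 (h1.eq (h1.sub h3)) ?_)
  rw [AddMonoidHom.add_apply, h2, zero_add] at h4
  exact Prod.ext h2 h4

theorem hasGaloisPermGroup_group8T2 {a b : ℚ}
    (h : Irreducible (palindromicEvenOctic a b))
    (hP : IsSquare ((b + 2 - 2 * a) * (a ^ 2 - 4 * b + 8)))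
    (hQ : IsSquare (b + 2 + 2 * a) ∨ IsSquare ((b + 2 + 2 * a) * (a ^ 2 - 4 * b + 8))) :
    HasGaloisPermGroup (palindromicEvenOctic a b) group8T2 := by
  obtain ⟨L, _, _, _, r, s, z, _, _, _, R, F⟩ := exists_splitting_blockFrame h
  obtain ⟨h1, h2⟩ := F.blockInvariant_of_isSquare_mul R R.form_add_inv hP
  have h3 : BlockInvariant (L ≃ₐ[ℚ] L) signInv r s (.fst _ _ + .snd _ _) :=
    hQ.elim (fun hQ => (F.blockInvariant_of_isSquare R.form_sub_inv hQ).1)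
      fun hQ => (F.blockInvariant_of_isSquare_mul R R.form_sub_inv hQ).1
  refine hasGaloisPermGroup_of_orbitsLabelledBy R
    (F.orbitsLabelledBy_group8T2 (h1.eq (h1.sub h3)) ?_)
  rintro rfl
  simp at h2

/-- The square PQD makes the second coordinate invariant with z.2 = 1; if K were diagonal the first
coordinate would be invariant too, and P or PD would be a square. -/
theorem hasGaloisPermGroup_group8T10_of_isSquare_snd {a b : ℚ}
    (h : Irreducible (palindromicEvenOctic a b))
    (hPQ : IsSquare (((b + 2 - 2 * a) * (b + 2 + 2 * a)) * (a ^ 2 - 4 * b + 8)))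
    (hn1 : ¬ IsSquare (b + 2 - 2 * a))
    (hn1' : ¬ IsSquare ((b + 2 - 2 * a) * (a ^ 2 - 4 * b + 8))) :
    HasGaloisPermGroup (palindromicEvenOctic a b) group8T10 := by
  obtain ⟨L, _, _, _, r, s, z, _, _, _, R, F⟩ := exists_splitting_blockFrame h
  obtain ⟨h1, h2⟩ := F.blockInvariant_of_isSquare_mul R R.form_sq_sub_inv_sq hPQ
  refine hasGaloisPermGroup_of_orbitsLabelledBy R
    (F.orbitsLabelledBy_group8T10 h1 (by rw [h2]; decide) fun hd => ?_)
  exact (F.isSquare_of_blockInvariant R R.form_add_inv fun x y hxy => by rw [hd x y hxy]).elim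
    hn1 hn1'

theorem hasGaloisPermGroup_group8T10_of_isSquare_fst {a b : ℚ}
    (h : Irreducible (palindromicEvenOctic a b))
    (hP : IsSquare ((b + 2 - 2 * a) * (a ^ 2 - 4 * b + 8)))
    (hn1 : ¬ IsSquare (b + 2 + 2 * a))
    (hn1' : ¬ IsSquare ((b + 2 + 2 * a) * (a ^ 2 - 4 * b + 8))) :
    HasGaloisPermGroup (palindromicEvenOctic a b) group8T10 := by
  obtain ⟨L, _, _, _, r, s, z, _, _, _, R, F⟩ := exists_splitting_blockFrame h
  obtain ⟨h1, h2⟩ := F.blockInvariant_of_isSquare_mul R R.form_add_inv hP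
  refine hasGaloisPermGroup_of_orbitsLabelledBy R
    (F.orbitsLabelledBy_group8T10 h1 (by rw [h2]; decide) fun hd => ?_)
  exact (F.isSquare_of_blockInvariant R R.form_sub_inv fun x y hxy => by rw [hd x y hxy]).elim
    hn1 hn1'

theorem hasGaloisPermGroup_group8T18 {a b : ℚ}
    (h : Irreducible (palindromicEvenOctic a b))
    (hn1 : ¬ IsSquare (b + 2 - 2 * a))
    (hn1' : ¬ IsSquare ((b + 2 - 2 * a) * (a ^ 2 - 4 * b + 8)))
    (hn2 : ¬ IsSquare (b + 2 + 2 * a))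
    (hn2' : ¬ IsSquare ((b + 2 + 2 * a) * (a ^ 2 - 4 * b + 8)))
    (hn3 : ¬ IsSquare ((b + 2 - 2 * a) * (b + 2 + 2 * a)))
    (hn3' : ¬ IsSquare (((b + 2 - 2 * a) * (b + 2 + 2 * a)) * (a ^ 2 - 4 * b + 8))) :
    HasGaloisPermGroup (palindromicEvenOctic a b) group8T18 := by
  obtain ⟨L, _, _, _, r, s, z, _, _, _, R, F⟩ := exists_splitting_blockFrame h
  refine hasGaloisPermGroup_of_orbitsLabelledBy R (F.orbitsLabelledBy_group8T18 fun χ hχ hi => ?_)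
  rcases ZMod.two_prod_hom_cases hχ with rfl | rfl | rfl
  · exact (F.isSquare_of_blockInvariant R R.form_add_inv hi).elim hn1 hn1'
  · exact (F.isSquare_of_blockInvariant R R.form_sub_inv hi).elim hn2 hn2'
  · exact (F.isSquare_of_blockInvariant R R.form_sq_sub_inv_sq hi).elim hn3 hn3'

/-- The left side is (u + 2)(v - 2) + (v + 2)(u - 2) = 2uv - 8. -/
theorem OcticRoots.trace_add_inv_sub_inv {L : Type*} [Field L] [CharZero L] {a b : ℚ} {r s : L}
    (R : OcticRoots a b r s) : ((r + r⁻¹) * (s - s⁻¹)) ^ 2 + ((s + s⁻¹) * (r - r⁻¹)) ^ 2 =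
      ((2 * b - 12 : ℚ) : L) := by
  have h2 := R.prod
  have h3 := mul_inv_cancel₀ R.ne_zero
  have h4 := mul_inv_cancel₀ R.ne_zero'
  push_cast
  generalize r⁻¹ = r' at *
  generalize s⁻¹ = s' at *
  have e1 : (r - r') ^ 2 = r ^ 2 + r' ^ 2 - 2 := by linear_combination -2 * h3
  have e2 : (s - s') ^ 2 = s ^ 2 + s' ^ 2 - 2 := by linear_combination -2 * h4
  have e3 : (r + r') ^ 2 = r ^ 2 + r' ^ 2 + 2 := by linear_combination 2 * h3
  have e4 : (s + s') ^ 2 = s ^ 2 + s' ^ 2 + 2 := by linear_combination 2 * h4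
  rw [mul_pow, mul_pow, e1, e2, e3, e4]
  linear_combination 2 * h2

/-- Since y² - y⁻² = (y - y⁻¹)(y + y⁻¹), the norm Q of y - y⁻¹ factors out and leaves the trace of y
+ y⁻¹. -/
theorem OcticRoots.trace_sub_inv_sq_sub_inv_sq {L : Type*} [Field L] [CharZero L] {a b : ℚ}
    {r s : L} (R : OcticRoots a b r s) :
    ((r - r⁻¹) * (s ^ 2 - s⁻¹ ^ 2)) ^ 2 + ((s - s⁻¹) * (r ^ 2 - r⁻¹ ^ 2)) ^ 2 =
      (((b + 2 + 2 * a) * (4 - a) : ℚ) : L) := by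
  have h1 := R.form_sub_inv.norm
  have h2 := R.form_add_inv.trace
  rw [Rat.cast_mul, ← h1, ← h2]
  ring

theorem hasGaloisPermGroup_group8T4_of_isSquare_snd {a b : ℚ}
    (h : Irreducible (palindromicEvenOctic a b))
    (hPQ : IsSquare ((b + 2 - 2 * a) * (b + 2 + 2 * a)))
    (hn1 : ¬ IsSquare (b + 2 - 2 * a))
    (hn1' : ¬ IsSquare ((b + 2 - 2 * a) * (a ^ 2 - 4 * b + 8)))
    {m : ℚ}
    (hm : m ^ 2 = (b + 2 - 2 * a) * (b + 2 + 2 * a))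
    (hsq : IsSquare (2 * b - 12 + 2 * m))
    (hne : 2 * b - 12 + 2 * m ≠ 0) :
    HasGaloisPermGroup (palindromicEvenOctic a b) group8T4 := by
  obtain ⟨L, _, _, _, r, s, z, _, _, _, R, F⟩ := exists_splitting_blockFrame h
  obtain ⟨h1, h2⟩ := F.blockInvariant_of_isSquare R.form_sq_sub_inv_sq hPQ
  have hff : (.fst _ _ + .fst _ _ : ZMod 2 × ZMod 2 →+ ZMod 2) = 0 :=
    AddMonoidHom.ext fun x => CharTwo.add_self_eq_zero _
  -- The invariant character is the sum of the other two, which are carried by y + y⁻¹ and y - y⁻¹.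
  have hinv : BlockInvariant (L ≃ₐ[ℚ] L) signInv r s (.fst _ _ + (.fst _ _ + .snd _ _)) := by
    rw [← add_assoc, hff, zero_add]
    exact h1
  have hn : ¬ BlockInvariant (L ≃ₐ[ℚ] L) signInv r s _ := fun hi =>
    (F.isSquare_of_blockInvariant R R.form_add_inv hi).elim hn1 hn1'
  refine hasGaloisPermGroup_of_orbitsLabelledBy R (F.orbitsLabelledBy_group8T4
    AddMonoidHom.snd_ne_zero_two h1 (fun hd => hn fun x y hxy => by rw [hd x y hxy]) fun c hc => ?_)
  obtain ⟨h3, h4⟩ := eq_zero_of_isSquare R.form_add_inv R.form_sub_inv R.trace_add_inv_sub_inv hinv hm hsq hne hc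
  simp only [AddMonoidHom.add_apply, AddMonoidHom.coe_fst, AddMonoidHom.coe_snd] at h3 h4
  refine Prod.ext ?_ ?_ <;> simp_all

theorem hasGaloisPermGroup_group8T9_of_isSquare_snd {a b : ℚ}
    (h : Irreducible (palindromicEvenOctic a b))
    (hPQ : IsSquare ((b + 2 - 2 * a) * (b + 2 + 2 * a)))
    (hn1 : ¬ IsSquare (b + 2 - 2 * a))
    (hn1' : ¬ IsSquare ((b + 2 - 2 * a) * (a ^ 2 - 4 * b + 8)))
    (hT : ∀ m : ℚ, m ^ 2 = (b + 2 - 2 * a) * (b + 2 + 2 * a) →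
      ¬ IsSquare (2 * b - 12 + 2 * m)) :
    HasGaloisPermGroup (palindromicEvenOctic a b) group8T9 := by
  obtain ⟨L, _, _, _, r, s, z, _, _, _, R, F⟩ := exists_splitting_blockFrame h
  obtain ⟨h1, h2⟩ := F.blockInvariant_of_isSquare R.form_sq_sub_inv_sq hPQ
  have hff : (.fst _ _ + .fst _ _ : ZMod 2 × ZMod 2 →+ ZMod 2) = 0 :=
    AddMonoidHom.ext fun x => CharTwo.add_self_eq_zero _
  have hinv : BlockInvariant (L ≃ₐ[ℚ] L) signInv r s (.fst _ _ + (.fst _ _ + .snd _ _)) := by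
    rw [← add_assoc, hff, zero_add]
    exact h1
  have hn : ¬ BlockInvariant (L ≃ₐ[ℚ] L) signInv r s _ := fun hi =>
    (F.isSquare_of_blockInvariant R R.form_add_inv hi).elim hn1 hn1'
  -- Otherwise K would be the graph of an involution exchanging the two other characters, and some T
  -- + 2m would be a square.
  have hc : ∃ c, BlockRel (L ≃ₐ[ℚ] L) signInv r s 0 c ∧ c ≠ 0 := by
    by_contra! hc
    obtain ⟨m, hm, hsq⟩ := isSquare_of_graph F R.form_add_inv R.form_sub_inv R.trace_add_inv_sub_inv
      fun x y hxy => F.hom_eq_hom_of_graph AddMonoidHom.fst_ne_zero_two AddMonoidHom.fst_add_snd_ne_zero_two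
        (fun h => by simpa using DFunLike.congr_fun h (1, 1)) rfl hinv hn hc hxy
    exact hT m hm hsq
  obtain ⟨c, hc, hc0⟩ := hc
  exact hasGaloisPermGroup_of_orbitsLabelledBy R (F.orbitsLabelledBy_group8T9
    AddMonoidHom.snd_ne_zero_two h1 h2 hc0 hc)

theorem hasGaloisPermGroup_group8T4_of_isSquare_fst {a b : ℚ}
    (h : Irreducible (palindromicEvenOctic a b))
    (hP : IsSquare (b + 2 - 2 * a))
    (hn1 : ¬ IsSquare (b + 2 + 2 * a))
    (hn1' : ¬ IsSquare ((b + 2 + 2 * a) * (a ^ 2 - 4 * b + 8)))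
    {m : ℚ}
    (hm : m ^ 2 = (b + 2 + 2 * a) * ((b + 2 - 2 * a) * (b + 2 + 2 * a)))
    (hsq : IsSquare ((b + 2 + 2 * a) * (4 - a) + 2 * m))
    (hne : (b + 2 + 2 * a) * (4 - a) + 2 * m ≠ 0) :
    HasGaloisPermGroup (palindromicEvenOctic a b) group8T4 := by
  obtain ⟨L, _, _, _, r, s, z, _, _, _, R, F⟩ := exists_splitting_blockFrame h
  obtain ⟨h1, h2⟩ := F.blockInvariant_of_isSquare R.form_add_inv hP
  have hff : (.snd _ _ + .snd _ _ : ZMod 2 × ZMod 2 →+ ZMod 2) = 0 :=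
    AddMonoidHom.ext fun x => CharTwo.add_self_eq_zero _
  have hinv : BlockInvariant (L ≃ₐ[ℚ] L) signInv r s (.fst _ _ + .snd _ _ + .snd _ _) := by
    rw [add_assoc, hff, add_zero]
    exact h1
  -- Now P is a square, so the other two characters are those of y - y⁻¹ and y² - y⁻², of norms Q
  -- and PQ.
  have hn : ¬ BlockInvariant (L ≃ₐ[ℚ] L) signInv r s _ := fun hi =>
    (F.isSquare_of_blockInvariant R R.form_sub_inv hi).elim hn1 hn1'
  refine hasGaloisPermGroup_of_orbitsLabelledBy R (F.orbitsLabelledBy_group8T4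
    AddMonoidHom.fst_ne_zero_two h1 (fun hd => hn fun x y hxy => by rw [hd x y hxy]) fun c hc => ?_)
  obtain ⟨h3, h4⟩ := eq_zero_of_isSquare R.form_sub_inv R.form_sq_sub_inv_sq R.trace_sub_inv_sq_sub_inv_sq hinv hm hsq hne hc
  simp only [AddMonoidHom.add_apply, AddMonoidHom.coe_fst, AddMonoidHom.coe_snd] at h3 h4
  refine Prod.ext ?_ ?_ <;> simp_all

theorem hasGaloisPermGroup_group8T9_of_isSquare_fst {a b : ℚ}
    (h : Irreducible (palindromicEvenOctic a b))
    (hP : IsSquare (b + 2 - 2 * a))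
    (hn1 : ¬ IsSquare (b + 2 + 2 * a))
    (hn1' : ¬ IsSquare ((b + 2 + 2 * a) * (a ^ 2 - 4 * b + 8)))
    (hT : ∀ m : ℚ, m ^ 2 = (b + 2 + 2 * a) * ((b + 2 - 2 * a) * (b + 2 + 2 * a)) →
      ¬ IsSquare ((b + 2 + 2 * a) * (4 - a) + 2 * m)) :
    HasGaloisPermGroup (palindromicEvenOctic a b) group8T9 := by
  obtain ⟨L, _, _, _, r, s, z, _, _, _, R, F⟩ := exists_splitting_blockFrame h
  obtain ⟨h1, h2⟩ := F.blockInvariant_of_isSquare R.form_add_inv hP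
  have hff : (.snd _ _ + .snd _ _ : ZMod 2 × ZMod 2 →+ ZMod 2) = 0 :=
    AddMonoidHom.ext fun x => CharTwo.add_self_eq_zero _
  have hinv : BlockInvariant (L ≃ₐ[ℚ] L) signInv r s (.fst _ _ + .snd _ _ + .snd _ _) := by
    rw [add_assoc, hff, add_zero]
    exact h1
  have hn : ¬ BlockInvariant (L ≃ₐ[ℚ] L) signInv r s _ := fun hi =>
    (F.isSquare_of_blockInvariant R R.form_sub_inv hi).elim hn1 hn1'
  have hc : ∃ c, BlockRel (L ≃ₐ[ℚ] L) signInv r s 0 c ∧ c ≠ 0 := by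
    by_contra! hc
    obtain ⟨m, hm, hsq⟩ := isSquare_of_graph F R.form_sub_inv R.form_sq_sub_inv_sq R.trace_sub_inv_sq_sub_inv_sq
      fun x y hxy => F.hom_eq_hom_of_graph AddMonoidHom.fst_add_snd_ne_zero_two AddMonoidHom.snd_ne_zero_two
        (fun h => by simpa using DFunLike.congr_fun h (1, 1)) rfl hinv hn hc hxy
    exact hT m hm hsq
  obtain ⟨c, hc, hc0⟩ := hc
  exact hasGaloisPermGroup_of_orbitsLabelledBy R (F.orbitsLabelledBy_group8T9
    AddMonoidHom.fst_ne_zero_two h1 h2 hc0 hc)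

/-! ### The ten examples. -/

theorem forall_sq_eq_of_not_isSquare {x y : ℚ} (h : ¬ IsSquare x) (m : ℚ) (hm : m ^ 2 = x) :
    ¬ IsSquare (y + 2 * m) := (h ⟨m, by rw [← hm, sq]⟩).elim

theorem forall_sq_eq_of_sq {x y : ℚ} (k : ℚ) (h : x = k ^ 2) (h₁ : ¬ IsSquare (y + 2 * k))
    (h₂ : ¬ IsSquare (y - 2 * k)) (m : ℚ) (hm : m ^ 2 = x) : ¬ IsSquare (y + 2 * m) := by
  rcases sq_eq_sq_iff_eq_or_eq_neg.1 (hm.trans h) with rfl | rfl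
  · exact h₁
  · rwa [mul_neg, ← sub_eq_add_neg]

theorem proposition4p2 :
    (∀ a b : ℚ, a ≠ 0 → Irreducible (palindromicEvenOctic a b) →
      ((IsE4 (palindromicQuartic a b).Gal →
          HasGaloisPermGroup (palindromicEvenOctic a b) group8T2 ∨
          HasGaloisPermGroup (palindromicEvenOctic a b) group8T3 ∨
          HasGaloisPermGroup (palindromicEvenOctic a b) group8T4 ∨
          HasGaloisPermGroup (palindromicEvenOctic a b) group8T9) ∧
       (IsC4 (palindromicQuartic a b).Gal →
          HasGaloisPermGroup (palindromicEvenOctic a b) group8T2 ∨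
          HasGaloisPermGroup (palindromicEvenOctic a b) group8T10) ∧
       (IsD4 (palindromicQuartic a b).Gal →
          HasGaloisPermGroup (palindromicEvenOctic a b) group8T4 ∨
          HasGaloisPermGroup (palindromicEvenOctic a b) group8T9 ∨
          HasGaloisPermGroup (palindromicEvenOctic a b) group8T10 ∨
          HasGaloisPermGroup (palindromicEvenOctic a b) group8T18))) ∧
    (∃ a b : ℚ, a ≠ 0 ∧ Irreducible (palindromicEvenOctic a b) ∧
      IsE4 (palindromicQuartic a b).Gal ∧
      HasGaloisPermGroup (palindromicEvenOctic a b) group8T2) ∧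
    (∃ a b : ℚ, a ≠ 0 ∧ Irreducible (palindromicEvenOctic a b) ∧
      IsE4 (palindromicQuartic a b).Gal ∧
      HasGaloisPermGroup (palindromicEvenOctic a b) group8T3) ∧
    (∃ a b : ℚ, a ≠ 0 ∧ Irreducible (palindromicEvenOctic a b) ∧
      IsE4 (palindromicQuartic a b).Gal ∧
      HasGaloisPermGroup (palindromicEvenOctic a b) group8T4) ∧
    (∃ a b : ℚ, a ≠ 0 ∧ Irreducible (palindromicEvenOctic a b) ∧
      IsE4 (palindromicQuartic a b).Gal ∧
      HasGaloisPermGroup (palindromicEvenOctic a b) group8T9) ∧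
    (∃ a b : ℚ, a ≠ 0 ∧ Irreducible (palindromicEvenOctic a b) ∧
      IsC4 (palindromicQuartic a b).Gal ∧
      HasGaloisPermGroup (palindromicEvenOctic a b) group8T2) ∧
    (∃ a b : ℚ, a ≠ 0 ∧ Irreducible (palindromicEvenOctic a b) ∧
      IsC4 (palindromicQuartic a b).Gal ∧
      HasGaloisPermGroup (palindromicEvenOctic a b) group8T10) ∧
    (∃ a b : ℚ, a ≠ 0 ∧ Irreducible (palindromicEvenOctic a b) ∧
      IsD4 (palindromicQuartic a b).Gal ∧
      HasGaloisPermGroup (palindromicEvenOctic a b) group8T4) ∧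
    (∃ a b : ℚ, a ≠ 0 ∧ Irreducible (palindromicEvenOctic a b) ∧
      IsD4 (palindromicQuartic a b).Gal ∧
      HasGaloisPermGroup (palindromicEvenOctic a b) group8T9) ∧
    (∃ a b : ℚ, a ≠ 0 ∧ Irreducible (palindromicEvenOctic a b) ∧
      IsD4 (palindromicQuartic a b).Gal ∧
      HasGaloisPermGroup (palindromicEvenOctic a b) group8T10) ∧
    (∃ a b : ℚ, a ≠ 0 ∧ Irreducible (palindromicEvenOctic a b) ∧
      IsD4 (palindromicQuartic a b).Gal ∧
      HasGaloisPermGroup (palindromicEvenOctic a b) group8T18) := by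
  refine ⟨fun a b _ h => hasGaloisPermGroup_cases h, ?_, ?_, ?_, ?_, ?_, ?_, ?_, ?_, ?_, ?_⟩
  -- P = 98, Q = 2, D = 392: PQ, PD and QD are squares.
  · have h : Irreducible (palindromicEvenOctic (-24) 48) :=
      palindromicEvenOctic_irreducible (by norm_num) (by norm_num) (by norm_num)
        (forall_sq_eq_of_not_isSquare (by norm_num))
        (forall_sq_eq_of_not_isSquare (by norm_num))
        (forall_sq_eq_of_sq 14 (by norm_num) (by norm_num) (by norm_num))
    exact ⟨-24, 48, by norm_num, h, isE4_gal_of_isSquare h (by norm_num),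
      hasGaloisPermGroup_group8T2 h (by norm_num) (.inr (by norm_num))⟩
  -- P = 16, Q = 4, D = -15: P and Q are squares.
  · have h : Irreducible (palindromicEvenOctic (-3) 8) :=
      palindromicEvenOctic_irreducible (by norm_num) (by norm_num) (by norm_num)
        (forall_sq_eq_of_sq 4 (by norm_num) (by norm_num) (by norm_num))
        (forall_sq_eq_of_sq 2 (by norm_num) (by norm_num) (by norm_num))
        (forall_sq_eq_of_sq 8 (by norm_num) (by norm_num) (by norm_num))
    exact ⟨-3, 8, by norm_num, h, isE4_gal_of_isSquare h (by norm_num),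
      hasGaloisPermGroup_group8T3 h (by norm_num) (by norm_num)⟩
  -- P = 2, Q = 18, D = -8: PQ = 6², and T + 2·6 = 16 with T = 4.
  · have h : Irreducible (palindromicEvenOctic 4 8) :=
      palindromicEvenOctic_irreducible (by norm_num) (by norm_num) (by norm_num)
        (forall_sq_eq_of_not_isSquare (by norm_num))
        (forall_sq_eq_of_not_isSquare (by norm_num))
        (forall_sq_eq_of_sq 6 (by norm_num) (by norm_num) (by norm_num))
    exact ⟨4, 8, by norm_num, h, isE4_gal_of_isSquare h (by norm_num),
      hasGaloisPermGroup_group8T4_of_isSquare_snd h (by norm_num) (by norm_num) (by norm_num)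
      (m := 6) (by norm_num) (by norm_num) (by norm_num)⟩
  -- P = -9, Q = -1, D = 40: PQ = 3², and T ± 2·3 is negative, since T = -26.
  · have h : Irreducible (palindromicEvenOctic 2 (-7)) :=
      palindromicEvenOctic_irreducible (by norm_num) (by norm_num) (by norm_num)
        (forall_sq_eq_of_not_isSquare (by norm_num))
        (forall_sq_eq_of_not_isSquare (by norm_num))
        (forall_sq_eq_of_sq 3 (by norm_num) (by norm_num) (by norm_num))
    exact ⟨2, -7, by norm_num, h, isE4_gal_of_isSquare h (by norm_num),
      hasGaloisPermGroup_group8T9_of_isSquare_snd h (by norm_num) (by norm_num) (by norm_num)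
        (forall_sq_eq_of_sq 3 (by norm_num) (by norm_num) (by norm_num))⟩
  -- The cyclotomic polynomial Φ₂₀: P = D = 5, Q = 1.
  · have h : Irreducible (palindromicEvenOctic (-1) 1) :=
      palindromicEvenOctic_irreducible (by norm_num) (by norm_num) (by norm_num)
        (forall_sq_eq_of_not_isSquare (by norm_num))
        (forall_sq_eq_of_sq 1 (by norm_num) (by norm_num) (by norm_num))
        (forall_sq_eq_of_not_isSquare (by norm_num))
    exact ⟨-1, 1, by norm_num, h, isC4_gal_of_isSquare h (by norm_num),
      hasGaloisPermGroup_group8T2 h (by norm_num) (.inl (by norm_num))⟩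
  -- P = -9, Q = -5, D = 45: PQ = D.
  · have h : Irreducible (palindromicEvenOctic 1 (-9)) :=
      palindromicEvenOctic_irreducible (by norm_num) (by norm_num) (by norm_num)
        (forall_sq_eq_of_not_isSquare (by norm_num))
        (forall_sq_eq_of_not_isSquare (by norm_num))
        (forall_sq_eq_of_not_isSquare (by norm_num))
    exact ⟨1, -9, by norm_num, h, isC4_gal_of_isSquare h (by norm_num),
      hasGaloisPermGroup_group8T10_of_isSquare_snd h (by norm_num) (by norm_num) (by norm_num)⟩
  -- P = 16, Q = 32, D = -64: here T = 0, PQ² = 128², and 2·128 = 16².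
  · have h : Irreducible (palindromicEvenOctic 4 22) :=
      palindromicEvenOctic_irreducible (by norm_num) (by norm_num) (by norm_num)
        (forall_sq_eq_of_sq 4 (by norm_num) (by norm_num) (by norm_num))
        (forall_sq_eq_of_not_isSquare (by norm_num))
        (forall_sq_eq_of_not_isSquare (by norm_num))
    exact ⟨4, 22, by norm_num, h, isD4_gal_of_not_isSquare h (by norm_num) (by norm_num),
      hasGaloisPermGroup_group8T4_of_isSquare_fst h (by norm_num) (by norm_num) (by norm_num)
      (m := 128) (by norm_num) (by norm_num) (by norm_num)⟩
  -- P = 4, Q = 8, D = -7: T = 24, PQ² = 16², and neither 56 nor -8 is a square.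
  · have h : Irreducible (palindromicEvenOctic 1 4) :=
      palindromicEvenOctic_irreducible (by norm_num) (by norm_num) (by norm_num)
        (forall_sq_eq_of_sq 2 (by norm_num) (by norm_num) (by norm_num))
        (forall_sq_eq_of_not_isSquare (by norm_num))
        (forall_sq_eq_of_not_isSquare (by norm_num))
    exact ⟨1, 4, by norm_num, h, isD4_gal_of_not_isSquare h (by norm_num) (by norm_num),
      hasGaloisPermGroup_group8T9_of_isSquare_fst h (by norm_num) (by norm_num) (by norm_num)
        (forall_sq_eq_of_sq 16 (by norm_num) (by norm_num) (by norm_num))⟩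
  -- P = 8, Q = -8, D = 32: PD = 16², while QD and PQD are negative.
  · have h : Irreducible (palindromicEvenOctic (-4) (-2)) :=
      palindromicEvenOctic_irreducible (by norm_num) (by norm_num) (by norm_num)
        (forall_sq_eq_of_not_isSquare (by norm_num))
        (forall_sq_eq_of_not_isSquare (by norm_num))
        (forall_sq_eq_of_not_isSquare (by norm_num))
    exact ⟨-4, -2, by norm_num, h, isD4_gal_of_not_isSquare h (by norm_num) (by norm_num),
      hasGaloisPermGroup_group8T10_of_isSquare_fst h (by norm_num) (by norm_num) (by norm_num)⟩
  -- P = -1, Q = 3, D = 13: none of P, Q, PQ is a square, even after multiplication by D.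
  · have h : Irreducible (palindromicEvenOctic 1 (-1)) :=
      palindromicEvenOctic_irreducible (by norm_num) (by norm_num) (by norm_num)
        (forall_sq_eq_of_not_isSquare (by norm_num))
        (forall_sq_eq_of_not_isSquare (by norm_num))
        (forall_sq_eq_of_not_isSquare (by norm_num))
    exact ⟨1, -1, by norm_num, h, isD4_gal_of_not_isSquare h (by norm_num) (by norm_num),
      hasGaloisPermGroup_group8T18 h (by norm_num) (by norm_num) (by norm_num) (by norm_num)
      (by norm_num) (by norm_num)⟩
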